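/- Let $\mathcal P$ be a finite poset whose Hasse diagram $H=(V,E)$ (edges $(u,v)$ with $v$ covering $u$) has $p=|V|$ vertices and $q=|E|$ edges. Then there is an SM instance of size $n=2p$ ($2p$ men and $2p$ women) with complete preference lists whose rotation poset is isomorphic to $\mathcal P$, and it is obtained in time $O(p+q)$ from $H$, in the following sense. Label $V$ by $1,\dots,p$ and list the edges of $H$ in any order. Let $I$ be the instance with incomplete lists that $\mathsf{ConstructInstance}(H,\phi)$ builds when $\phi$ colours every edge $1$: every vertex $v$ gets the colours $C_v=\{1,2\}$, the men are $m_{c,v}$ and the women $w_{c,v}$ ($c\in\{1,2\}$, $v\in V$), and the lists, most preferred first, are - $m_{1,v}$: $w_{1,v}$, then the $w_{1,u}$ with $(u,v)\in E$ in the order of the edges, then $w_{2,v}$; $\quad m_{2,v}$: $w_{2,v}, w_{1,v}$; - $w_{1,v}$: $m_{2,v}$, then the $m_{1,x}$ with $(v,x)\in E$ in the reverse order of the edges, then $m_{1,v}$; $\quad w_{2,v}$: $m_{1,v}, m_{2,v}$. Then: 1. $I$ is an SM instance (its lists are consistent and every agent is matched in every stable matching) of size $2p$, and $I$ realizes $\mathcal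 P$: the rotation poset of $I$ is isomorphic to $\mathcal P$. 2. Every instance obtained from $I$ by appending to each list its missing agents, in any order (for example in increasing order of $(v,c)$), is an SM instance of size $2p$ with complete preference lists that realizes $\mathcal P$. 3. There are one program of a word RAM (unit-cost addition, subtraction, comparison with zero and indirect memory access) and one constant $K$ such that for all $\mathcal P$, all labellings and all orders of the edges, the program, given $p$, $q$ and the list of the edges of $H$, writes out all preference lists of $I$ in at most $K(p+q+1)$ steps, using only words that hold the numbers $0,\dots,K(p+q+1)$. These lists specify a complete instance of item 2, each list being continued by its missing agents in increasing order. (The entries added by the completion are not written out, since the complete lists have $8p^2$ entries in total.) -/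

import Mathlib

namespace StableMarriage

/-! ## Stable matching instances -/

/-- The data `(M, W, P)`: a finite set of men, a finite set of women, and for every agent a list of
acceptable partners, most preferred first. -/
structure Instance (A B : Type*) where
  men : Finset A
  women : Finset B
  manPref : A → List B
  womanPref : B → List A

namespace Instance

variable {A B : Type*} [DecidableEq A] [DecidableEq B]

/-- The man `m` ranks both `w` and `w'`, and ranks `w` before `w'`. -/
def ManPrefers (I : Instance A B) (m : A) (w w' : B) : Prop :=
  w ∈ I.manPref m ∧ w' ∈ I.manPref m ∧ (I.manPref m).idxOf w < (I.manPref m).idxOf w'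

/-- The woman `w` ranks both `m` and `m'`, and ranks `m` before `m'`. -/
def WomanPrefers (I : Instance A B) (w : B) (m m' : A) : Prop :=
  m ∈ I.womanPref w ∧ m' ∈ I.womanPref w ∧ (I.womanPref w).idxOf m < (I.womanPref w).idxOf m'

/-- `m` and `w` are acceptable to each other. -/
def Acceptable (I : Instance A B) (m : A) (w : B) : Prop :=
  m ∈ I.men ∧ w ∈ I.women ∧ w ∈ I.manPref m ∧ m ∈ I.womanPref w

/-- A matching: a set of acceptable pairs in which every agent occurs at most once. -/
def IsMatching (I : Instance A B) (μ : Set (A × B)) : Prop :=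
  (∀ m w, (m, w) ∈ μ → I.Acceptable m w) ∧
  (∀ m w w', (m, w) ∈ μ → (m, w') ∈ μ → w = w') ∧
  (∀ m m' w, (m, w) ∈ μ → (m', w) ∈ μ → m = m')

/-- `(m, w)` is acceptable, `m` is unmatched or prefers `w` to his partner, and `w` is unmatched or
prefers `m` to her partner. -/
def IsBlockingPair (I : Instance A B) (μ : Set (A × B)) (m : A) (w : B) : Prop :=
  I.Acceptable m w ∧
  (∀ w', (m, w') ∈ μ → I.ManPrefers m w w') ∧
  (∀ m', (m', w) ∈ μ → I.WomanPrefers w m m')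

def IsStable (I : Instance A B) (μ : Set (A × B)) : Prop :=
  I.IsMatching μ ∧ ∀ m w, ¬ I.IsBlockingPair μ m w

/-- An SM instance: the lists have no repetitions and contain only agents of the other side, they
are consistent (`w` is on the list of `m` iff `m` is on the list of `w`), and every agent is matched
in every stable matching. -/
structure IsSMInstance (I : Instance A B) : Prop where
  man_nodup : ∀ m ∈ I.men, (I.manPref m).Nodup
  woman_nodup : ∀ w ∈ I.women, (I.womanPref w).Nodup
  man_mem : ∀ m ∈ I.men, ∀ w ∈ I.manPref m, w ∈ I.women
  woman_mem : ∀ w ∈ I.women, ∀ m ∈ I.womanPref w, m ∈ I.men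
  consistent : ∀ m ∈ I.men, ∀ w ∈ I.women, w ∈ I.manPref m ↔ m ∈ I.womanPref w
  man_matched : ∀ μ, I.IsStable μ → ∀ m ∈ I.men, ∃ w, (m, w) ∈ μ
  woman_matched : ∀ μ, I.IsStable μ → ∀ w ∈ I.women, ∃ m, (m, w) ∈ μ

/-- There are `n` men and `n` women. -/
def HasSize (I : Instance A B) (n : ℕ) : Prop :=
  I.men.card = n ∧ I.women.card = n

/-- Every man ranks every woman and every woman ranks every man. -/
def HasCompleteLists (I : Instance A B) : Prop :=
  (∀ m ∈ I.men, ∀ w ∈ I.women, w ∈ I.manPref m) ∧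
  (∀ w ∈ I.women, ∀ m ∈ I.men, m ∈ I.womanPref w)

/-! ## Rotations and the rotation poset -/

/-- In the circular list `ρ`, some occurrence of `x` is immediately followed by `y`
(in a circular list of length one, its entry follows itself). -/
def Follows {X : Type*} (ρ : Cycle X) (x y : X) : Prop :=
  ∃ l : List X, ((x :: l : List X) : Cycle X) = ρ ∧ (l ++ [x]).head? = some y

/-- `w'` is the first woman after `w` on the list of `m` who prefers `m` to her partner in `μ`, and
that partner is `m'`. -/
def IsNextPair (I : Instance A B) (μ : Set (A × B)) (x y : A × B) : Prop :=
  y ∈ μ ∧ I.ManPrefers x.1 x.2 y.2 ∧ I.WomanPrefers y.2 x.1 y.1 ∧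
  ∀ w, I.ManPrefers x.1 x.2 w → I.ManPrefers x.1 w y.2 →
    ¬ ∃ m, (m, w) ∈ μ ∧ I.WomanPrefers w x.1 m

/-- `ρ` is a rotation exposed in the stable matching `μ`: a nonempty circular list of distinct pairs
of `μ`, each followed by its next pair. -/
def IsExposed (I : Instance A B) (μ : Set (A × B)) (ρ : Cycle (A × B)) : Prop :=
  I.IsStable μ ∧ ρ ≠ Cycle.nil ∧ ρ.Nodup ∧ (∀ x ∈ ρ, x ∈ μ) ∧
  ∀ x y, Follows ρ x y → I.IsNextPair μ x y

/-- The elimination of `ρ` from `μ`: the pairs `(m_i, w_i)` of `ρ` are replaced by the pairs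
`(m_i, w_{i+1})`. -/
def eliminate (μ : Set (A × B)) (ρ : Cycle (A × B)) : Set (A × B) :=
  {x | x ∈ μ ∧ x ∉ ρ} ∪ {z | ∃ x y, Follows ρ x y ∧ z = (x.1, y.2)}

/-- The set `R(I)` of the rotations exposed in some stable matching. -/
def rotations (I : Instance A B) : Set (Cycle (A × B)) :=
  {ρ | ∃ μ, I.IsExposed μ ρ}

/-- The stable matching in which every man has his best stable partner. -/
def IsManOptimal (I : Instance A B) (μ : Set (A × B)) : Prop :=
  I.IsStable μ ∧ ∀ μ', I.IsStable μ' → ∀ m w w', (m, w) ∈ μ → (m, w') ∈ μ' →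
    w = w' ∨ I.ManPrefers m w w'

/-- `μ` arises from the man-optimal stable matching by eliminating successively the rotations in the
set `S`, each of them exposed when it is eliminated. For every stable matching `μ` of an SM instance
there is exactly one such set `S`. -/
inductive ReachedBy (I : Instance A B) : Set (A × B) → Set (Cycle (A × B)) → Prop
  | start (μ : Set (A × B)) (h : I.IsManOptimal μ) : ReachedBy I μ ∅
  | step (μ : Set (A × B)) (S : Set (Cycle (A × B))) (ρ : Cycle (A × B))
      (h : ReachedBy I μ S) (hρ : I.IsExposed μ ρ) :
      ReachedBy I (eliminate μ ρ) (insert ρ S)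

/-- The set `R_μ` of the rotations eliminated on the way from the man-optimal stable matching to
`μ`. -/
def eliminated (I : Instance A B) (μ : Set (A × B)) : Set (Cycle (A × B)) :=
  {ρ | ∃ S, I.ReachedBy μ S ∧ ρ ∈ S}

/-- `ρ ≺ ρ'`: `ρ` was eliminated in every stable matching in which `ρ'` is exposed. -/
def Precedes (I : Instance A B) (ρ ρ' : Cycle (A × B)) : Prop :=
  ∀ μ, I.IsExposed μ ρ' → ρ ∈ I.eliminated μ

/-- `I` realizes the poset `α`: the rotation poset `(R(I), ≺)` is isomorphic to `(α, <)`. -/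
def Realizes (I : Instance A B) (α : Type*) [PartialOrder α] : Prop :=
  ∃ f : α ≃ I.rotations, ∀ x y : α, x < y ↔ I.Precedes (f x) (f y)

/-! ## Completing incomplete lists -/

/-- `J` arises from `I` by appending to the end of each list, in some order, the missing agents. -/
def IsCompletion (J I : Instance A B) : Prop :=
  J.men = I.men ∧ J.women = I.women ∧
  (∀ m ∈ I.men, I.manPref m <+: J.manPref m ∧ (J.manPref m).Nodup ∧
    ∀ w, w ∈ J.manPref m ↔ w ∈ I.women) ∧
  (∀ w ∈ I.women, I.womanPref w <+: J.womanPref w ∧ (J.womanPref w).Nodup ∧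
    ∀ m, m ∈ J.womanPref w ↔ m ∈ I.men)

/-- Append to every list the missing agents in the order of the listings `LM` of the men and `LW` of
the women. -/
def complete (I : Instance A B) (LM : List A) (LW : List B) : Instance A B where
  men := I.men
  women := I.women
  manPref m := I.manPref m ++ LW.filter (fun w => w ∉ I.manPref m)
  womanPref w := I.womanPref w ++ LM.filter (fun m => m ∉ I.womanPref w)

/-- The preference lists written out as a word. The men are numbered `0, 1, …` by their position in
the listing `LM` and the women by their position in `LW`. The word contains for each man, and then
for each woman, the length of the list followed by the numbers of its entries. -/
def code (I : Instance A B) (LM : List A) (LW : List B) : List ℕ :=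
  LM.flatMap (fun m => (I.manPref m).length :: (I.manPref m).map (fun w => LW.idxOf w)) ++
  LW.flatMap (fun w => (I.womanPref w).length :: (I.womanPref w).map (fun m => LM.idxOf m))

end Instance

/-! ## The construction from an edge-coloured Hasse diagram -/

/-- The list `E` contains, in some order, each edge of the Hasse diagram of `α` exactly once, where
the vertices are labelled by `e`. -/
def IsHasseEdgeList {α : Type*} [PartialOrder α] {p : ℕ} (e : Fin p ≃ α)
    (E : List (Fin p × Fin p)) : Prop :=
  E.Nodup ∧ ∀ u v, (u, v) ∈ E ↔ e u ⋖ e v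

section Construction

variable {p : ℕ} (E : List (Fin p × Fin p)) (φ : Fin p × Fin p → ℕ)

/-- The set `C_v`: the colours of the edges incident to `v`, where `1` and/or `2` are added if there
are fewer than two colours. -/
def colorSet (v : Fin p) : Finset ℕ :=
  let C : Finset ℕ := ((E.filter (fun e => e.1 = v ∨ e.2 = v)).map φ).toFinset
  if C.card = 0 then {1, 2}
  else if C.card = 1 then (if 1 ∈ C then insert 2 C else insert 1 C)
  else C

/-- The cyclic ordering `π_v` of `C_v`: the increasing one. -/
def colorList (v : Fin p) : List ℕ := (colorSet E φ v).sort (· ≤ ·)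

/-- The colour `c⁺` after `c` in the cyclic ordering of `C_v`. -/
def nextColor (v : Fin p) (c : ℕ) : ℕ :=
  let l := colorList E φ v
  l.getD ((l.idxOf c + 1) % l.length) 0

/-- The colour `c⁻` before `c` in the cyclic ordering of `C_v`. -/
def prevColor (v : Fin p) (c : ℕ) : ℕ :=
  let l := colorList E φ v
  l.getD ((l.idxOf c + (l.length - 1)) % l.length) 0

/-- The pairs `(v, c)` with `c ∈ C_v`, in lexicographic order. -/
def agentList : List (Fin p × ℕ) :=
  (List.finRange p).flatMap (fun v => (colorList E φ v).map (fun c => (v, c)))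

/-- The instance constructed from the edge list `E` and the edge colouring `φ`. Both the man
`m_{c,v}` and the woman `w_{c,v}` are written `(v, c)`. First `m_{c,v}` and `w_{c,v}` are put on each
other's list; then for every edge `(u, v)` of colour `c`, in the order of `E`, the woman `w_{c,u}` is
added at the end of the list of `m_{c,v}` and `m_{c,v}` at the front of the list of `w_{c,u}`;
finally `w_{c⁺,v}` is added at the end of the list of `m_{c,v}` and `m_{c,v}` at the front of the
list of `w_{c⁺,v}`. -/
def constructInstance : Instance (Fin p × ℕ) (Fin p × ℕ) where
  men := (agentList E φ).toFinset
  women := (agentList E φ).toFinset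
  manPref := fun a =>
    (a.1, a.2) :: ((E.filter (fun e => e.2 = a.1 ∧ φ e = a.2)).map (fun e => (e.1, a.2)) ++
      [(a.1, nextColor E φ a.1 a.2)])
  womanPref := fun a =>
    (a.1, prevColor E φ a.1 a.2) ::
      ((E.filter (fun e => e.1 = a.1 ∧ φ e = a.2)).reverse.map (fun e => (e.2, a.2)) ++
        [(a.1, a.2)])

end Construction

/-! ## Word RAM programs with a step count -/

/-- Programs of a random access machine with registers, a memory addressed by register contents, and
a write-only output tape. -/
inductive Prog
  | skip : Prog
  /-- `r := k` -/
  | const (r k : ℕ) : Prog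
  /-- `r := a + b` -/
  | add (r a b : ℕ) : Prog
  /-- `r := max (a - b) 0` -/
  | sub (r a b : ℕ) : Prog
  /-- `r := mem[a]` -/
  | load (r a : ℕ) : Prog
  /-- `mem[a] := b` -/
  | store (a b : ℕ) : Prog
  /-- write the content of `r` to the output tape -/
  | emit (r : ℕ) : Prog
  | seq (c d : Prog) : Prog
  /-- execute `c` if the content of `r` is nonzero, and `d` otherwise -/
  | ite (r : ℕ) (c d : Prog) : Prog
  /-- repeat `c` as long as the content of `r` is nonzero -/
  | while (r : ℕ) (c : Prog) : Prog

structure State where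
  reg : ℕ → ℕ
  mem : ℕ → ℕ
  out : List ℕ

/-- `Exec N c s s' t`: started in the state `s`, the program `c` halts in the state `s'` after
exactly `t` steps, on a machine whose words hold the numbers `0, …, N` (there is no transition for an
instruction whose result does not fit into a word). Every instruction and every test is one step. -/
inductive Exec (N : ℕ) : Prog → State → State → ℕ → Prop
  | skip (s : State) : Exec N .skip s s 1
  | const (s : State) (r k : ℕ) (h : k ≤ N) :
      Exec N (.const r k) s { s with reg := Function.update s.reg r k } 1
  | add (s : State) (r a b : ℕ) (h : s.reg a + s.reg b ≤ N) :
      Exec N (.add r a b) s { s with reg := Function.update s.reg r (s.reg a + s.reg b) } 1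
  | sub (s : State) (r a b : ℕ) :
      Exec N (.sub r a b) s { s with reg := Function.update s.reg r (s.reg a - s.reg b) } 1
  | load (s : State) (r a : ℕ) :
      Exec N (.load r a) s { s with reg := Function.update s.reg r (s.mem (s.reg a)) } 1
  | store (s : State) (a b : ℕ) :
      Exec N (.store a b) s { s with mem := Function.update s.mem (s.reg a) (s.reg b) } 1
  | emit (s : State) (r : ℕ) :
      Exec N (.emit r) s { s with out := s.out ++ [s.reg r] } 1
  | seq {s s' s'' : State} {c d : Prog} {t t' : ℕ} (h : Exec N c s s' t) (h' : Exec N d s' s'' t') :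
      Exec N (.seq c d) s s'' (t + t')
  | ite_true {s s' : State} {r : ℕ} {c d : Prog} {t : ℕ} (hr : s.reg r ≠ 0) (h : Exec N c s s' t) :
      Exec N (.ite r c d) s s' (t + 1)
  | ite_false {s s' : State} {r : ℕ} {c d : Prog} {t : ℕ} (hr : s.reg r = 0) (h : Exec N d s s' t) :
      Exec N (.ite r c d) s s' (t + 1)
  | while_true {s s' s'' : State} {r : ℕ} {c : Prog} {t t' : ℕ} (hr : s.reg r ≠ 0)
      (h : Exec N c s s' t) (h' : Exec N (.while r c) s' s'' t') :
      Exec N (.while r c) s s'' (t + t' + 1)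
  | while_false {s : State} {r : ℕ} {c : Prog} (hr : s.reg r = 0) : Exec N (.while r c) s s 1

/-- The initial state: the input word is in the memory cells `0, 1, …`, all other cells and all
registers are `0`, and the output tape is empty. -/
def State.init (input : List ℕ) : State where
  reg := fun _ => 0
  mem := fun i => input.getD i 0
  out := []

/-- On the given input, with words holding `0, …, N`, the program halts after at most `T` steps with
the given output. -/
def Prog.Computes (c : Prog) (N T : ℕ) (input output : List ℕ) : Prop :=
  ∃ (s : State) (t : ℕ), Exec N c (State.init input) s t ∧ t ≤ T ∧ s.out = output

/-- A directed graph on the vertices `0, …, p - 1` as an input word: `p`, the number of edges, and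
then the two ends of each edge. -/
def graphCode {p : ℕ} (E : List (Fin p × Fin p)) : List ℕ :=
  p :: E.length :: E.flatMap (fun e => [(e.1 : ℕ), (e.2 : ℕ)])

end StableMarriage

/-!
A vertex `v` contributes the men `m_{1,v}`, `m_{2,v}` and the women `w_{1,v}`, `w_{2,v}`, written
`(v, 1)` and `(v, 2)`. Every agent `a` is the first choice of the agent `b` at the end of the
constructed list of `a`. If `a` were unmatched or had a partner beyond this list, then `(a, b)` would
block, so the entries appended by a completion occur in no stable matching. The constructed instance
and its completions are therefore treated together, as instances with `IsGadget`.

In a stable matching every vertex is in one of two positions, before or after the exchange of the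
partners of `m_{1,v}` and `m_{2,v}`. If `(u, v)` is an edge, then `(m_{1,v}, w_{1,u})` blocks exactly
when `v` is after and `u` before its exchange. Hence the stable matchings are the `matchOf S` for the
sets `S` closed under predecessors (`IsGadget.isStable_matchOf`, `IsGadget.exists_eq_matchOf`). The
exposed rotations of `matchOf S` are the `rot v` for the minimal vertices `v` outside `S`
(`IsGadget.isExposed_rot`, `IsGadget.exists_of_isExposed`), and eliminating `rot v` adds `v` to `S`.
So `rot u` precedes `rot v` iff every closed set to which `v` can be added contains `u`, that is, iff
`u < v` (`IsGadget.precedes_iff`).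

The preference lists are written out in linear time by bucketing the edges by one of their ends: one
pass over the edges inserts each at the head of a linked list in the memory, and one pass over the
vertices writes out these lists. The same program is run for the men and for the women, with
different contents of the registers that hold the direction of the first pass and the roles of the
two ends (`exec_sideProg`). Exact effects of straight-line pieces come from the evaluator
`Prog.eval`; the loops are treated by induction, and the emission time is bounded by the total length
of the buckets, which is at most the number of edges (`sum_length_bucket`).
-/

namespace StableMarriage

open Instance

/-! ### Positions in lists -/

section Before

variable {X : Type*} [DecidableEq X]

/-- `x` and `y` are entries of `l`, and `x` comes first. This is the common form of
`Instance.ManPrefers` and `Instance.WomanPrefers`, which unfold to it. -/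
def Before (l : List X) (x y : X) : Prop := x ∈ l ∧ y ∈ l ∧ l.idxOf x < l.idxOf y

theorem Before.asymm {l : List X} {x y : X} (h : Before l x y) : ¬ Before l y x :=
  fun h' => lt_asymm h.2.2 h'.2.2

theorem Before.irrefl {l : List X} {x : X} : ¬ Before l x x := fun h => lt_irrefl _ h.2.2

theorem Before.trichotomy {l : List X} {x y : X} (hx : x ∈ l) (hy : y ∈ l) :
    x = y ∨ Before l x y ∨ Before l y x := by
  rcases lt_trichotomy (l.idxOf x) (l.idxOf y) with h | h | h
  · exact .inr (.inl ⟨hx, hy, h⟩)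
  · exact .inl ((List.idxOf_inj hx).1 h)
  · exact .inr (.inr ⟨hy, hx, h⟩)

theorem before_head_iff {l l' : List X} {a x : X} (h : a :: l <+: l') :
    Before l' a x ↔ x ∈ l' ∧ x ≠ a := by
  obtain ⟨t, rfl⟩ := h
  constructor
  · rintro ⟨_, hx, hlt⟩
    refine ⟨hx, ?_⟩
    rintro rfl
    exact lt_irrefl _ hlt
  · rintro ⟨hx, hne⟩
    refine ⟨by simp, hx, ?_⟩
    simp [List.idxOf_cons_ne _ hne.symm]

theorem not_before_head {l l' : List X} {a x : X} (h : a :: l <+: l') : ¬ Before l' x a := by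
  obtain ⟨t, rfl⟩ := h
  rintro ⟨_, _, hlt⟩
  simp at hlt

theorem before_last_iff {l l' : List X} {b x : X} (h : l ++ [b] <+: l') (hd : l'.Nodup) :
    Before l' x b ↔ x ∈ l := by
  obtain ⟨t, rfl⟩ := h
  have hb : b ∉ l := by
    intro hb
    have := (List.nodup_append.1 (List.nodup_append.1 hd).1).2.2 b hb b (by simp)
    exact this rfl
  have hi : (l ++ [b] ++ t).idxOf b = l.length := by
    rw [List.append_assoc, List.idxOf_append_of_notMem hb]
    simp
  unfold Before
  rw [hi]
  by_cases hx : x ∈ l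
  · have : (l ++ [b] ++ t).idxOf x < l.length := by
      rw [List.append_assoc, List.idxOf_append_of_mem hx]
      exact List.idxOf_lt_length_iff.2 hx
    simp only [hx, iff_true]
    exact ⟨by simp [hx], by simp, this⟩
  · have : l.length ≤ (l ++ [b] ++ t).idxOf x := by
      rw [List.append_assoc, List.idxOf_append_of_notMem hx]
      exact Nat.le_add_right _ _
    simp only [hx, iff_false]
    rintro ⟨_, _, h3⟩
    omega

end Before

/-! ### Pairs that follow each other in a circular list -/

theorem follows_coe_cons {X : Type*} (a : X) (l : List X) (y : X)
    (h : (l ++ [a]).head? = some y) : Follows ((a :: l : List X) : Cycle X) a y := ⟨l, rfl, h⟩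

theorem exists_follows {X : Type*} {ρ : Cycle X} {x : X} (hx : x ∈ ρ) :
    ∃ y ∈ ρ, Follows ρ x y := by
  induction ρ using Quotient.inductionOn' with | _ l =>
  have hx' : x ∈ l := hx
  obtain ⟨s, t, rfl⟩ := List.append_of_mem hx'
  have hr : ((x :: (t ++ s) : List X) : Cycle X) = ((s ++ x :: t : List X) : Cycle X) := by
    rw [Cycle.coe_eq_coe]
    have := @List.isRotated_append X s (x :: t)
    simpa using this.symm
  change ∃ y ∈ ((s ++ x :: t : List X) : Cycle X), Follows ((s ++ x :: t : List X) : Cycle X) x y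
  rw [← hr]
  rcases hl : t ++ s with _ | ⟨y, l'⟩
  · exact ⟨x, by simp, follows_coe_cons _ _ _ (by simp)⟩
  · exact ⟨y, by simp, follows_coe_cons _ _ _ (by simp)⟩

theorem follows_pair_iff {X : Type*} {a b x y : X} :
    Follows (([a, b] : List X) : Cycle X) x y ↔ (x = a ∧ y = b) ∨ (x = b ∧ y = a) := by
  constructor
  · rintro ⟨l, hl, hy⟩
    rw [Cycle.coe_eq_coe, List.isRotated_comm, List.isRotated_iff_mem_map_range] at hl
    simp [List.range_succ, List.rotate] at hl
    rcases hl with ⟨rfl, rfl⟩ | ⟨rfl, rfl⟩ | ⟨rfl, rfl⟩ <;> simp at hy <;> simp [hy]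
  · rintro (⟨rfl, rfl⟩ | ⟨rfl, rfl⟩)
    · exact follows_coe_cons _ _ _ (by simp)
    · have : (([y, x] : List X) : Cycle X) = (([x, y] : List X) : Cycle X) := by
        rw [Cycle.coe_eq_coe]
        exact ⟨1, by simp⟩
      rw [this]
      exact follows_coe_cons _ _ _ (by simp)

/-- A circular list without repetitions in which two entries follow each other consists of these two
entries. -/
theorem eq_pair_of_follows {X : Type*} {ρ : Cycle X} {a b : X} (hρ : ρ.Nodup) (hab : a ≠ b)
    (h : Follows ρ a b) (h' : ∀ y, Follows ρ b y → y = a) : ρ = (([a, b] : List X) : Cycle X) := by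
  obtain ⟨l, rfl, hl⟩ := h
  rcases l with _ | ⟨c, l⟩
  · simp at hl
    exact absurd hl hab
  · simp at hl
    subst hl
    have hr : ((a :: c :: l : List X) : Cycle X) = ((c :: (l ++ [a]) : List X) : Cycle X) := by
      rw [Cycle.coe_eq_coe]
      exact ⟨1, by simp⟩
    rcases l with _ | ⟨d, l⟩
    · rfl
    · have hd := h' d (hr ▸ follows_coe_cons _ _ _ (by simp))
      subst hd
      simp at hρ

/-! ### Instances that extend the lists of the construction -/

variable {p : ℕ} {E : List (Fin p × Fin p)} {J : Instance (Fin p × ℕ) (Fin p × ℕ)}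

/-- `J` has the agents `(v, 1)` and `(v, 2)` on either side, its lists are consistent, and they
begin with the lists constructed from the edge list `E` with all edges coloured `1`. Both the
constructed instance and all its completions are of this kind. -/
structure IsGadget (E : List (Fin p × Fin p)) (J : Instance (Fin p × ℕ) (Fin p × ℕ)) : Prop where
  mem_men : ∀ a, a ∈ J.men ↔ a.2 = 1 ∨ a.2 = 2
  mem_women : ∀ a, a ∈ J.women ↔ a.2 = 1 ∨ a.2 = 2
  man_one : ∀ v, ((v, 1) :: (E.filter (fun e => e.2 = v)).map (fun e => (e.1, 1))) ++ [(v, 2)] <+: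
    J.manPref (v, 1)
  man_two : ∀ v, [(v, 2)] ++ [(v, 1)] <+: J.manPref (v, 2)
  woman_one : ∀ v, ((v, 2) :: (E.filter (fun e => e.1 = v)).reverse.map (fun e => (e.2, 1))) ++
    [(v, 1)] <+: J.womanPref (v, 1)
  woman_two : ∀ v, [(v, 1)] ++ [(v, 2)] <+: J.womanPref (v, 2)
  man_nodup : ∀ m ∈ J.men, (J.manPref m).Nodup
  woman_nodup : ∀ w ∈ J.women, (J.womanPref w).Nodup
  man_mem : ∀ m ∈ J.men, ∀ w ∈ J.manPref m, w ∈ J.women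
  woman_mem : ∀ w ∈ J.women, ∀ m ∈ J.womanPref w, m ∈ J.men
  consistent : ∀ m ∈ J.men, ∀ w ∈ J.women, w ∈ J.manPref m ↔ m ∈ J.womanPref w

namespace IsGadget

theorem man_one_before_iff (hJ : IsGadget E J) {v : Fin p} {w : Fin p × ℕ} :
    J.ManPrefers (v, 1) w (v, 2) ↔ w = (v, 1) ∨ ∃ u, (u, v) ∈ E ∧ w = (u, 1) := by
  refine (before_last_iff (hJ.man_one v) (hJ.man_nodup _ ((hJ.mem_men _).2 (.inl rfl)))).trans ?_
  simp [eq_comm]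

theorem man_two_before_iff (hJ : IsGadget E J) {v : Fin p} {w : Fin p × ℕ} :
    J.ManPrefers (v, 2) w (v, 1) ↔ w = (v, 2) := by
  refine (before_last_iff (hJ.man_two v) (hJ.man_nodup _ ((hJ.mem_men _).2 (.inr rfl)))).trans ?_
  simp

theorem woman_one_before_iff (hJ : IsGadget E J) {v : Fin p} {m : Fin p × ℕ} :
    J.WomanPrefers (v, 1) m (v, 1) ↔ m = (v, 2) ∨ ∃ x, (v, x) ∈ E ∧ m = (x, 1) := by
  refine (before_last_iff (hJ.woman_one v)
    (hJ.woman_nodup _ ((hJ.mem_women _).2 (.inl rfl)))).trans ?_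
  simp [eq_comm]

theorem woman_two_before_iff (hJ : IsGadget E J) {v : Fin p} {m : Fin p × ℕ} :
    J.WomanPrefers (v, 2) m (v, 2) ↔ m = (v, 1) := by
  refine (before_last_iff (hJ.woman_two v)
    (hJ.woman_nodup _ ((hJ.mem_women _).2 (.inr rfl)))).trans ?_
  simp

theorem man_one_top_iff (hJ : IsGadget E J) {v : Fin p} {w : Fin p × ℕ} :
    J.ManPrefers (v, 1) (v, 1) w ↔ w ∈ J.manPref (v, 1) ∧ w ≠ (v, 1) :=
  before_head_iff (hJ.man_one v)

theorem man_two_top_iff (hJ : IsGadget E J) {v : Fin p} {w : Fin p × ℕ} :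
    J.ManPrefers (v, 2) (v, 2) w ↔ w ∈ J.manPref (v, 2) ∧ w ≠ (v, 2) :=
  before_head_iff (hJ.man_two v)

theorem not_man_one_top (hJ : IsGadget E J) {v : Fin p} {w : Fin p × ℕ} :
    ¬ J.ManPrefers (v, 1) w (v, 1) := not_before_head (hJ.man_one v)

theorem not_man_two_top (hJ : IsGadget E J) {v : Fin p} {w : Fin p × ℕ} :
    ¬ J.ManPrefers (v, 2) w (v, 2) := not_before_head (hJ.man_two v)

theorem not_woman_one_top (hJ : IsGadget E J) {v : Fin p} {m : Fin p × ℕ} :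
    ¬ J.WomanPrefers (v, 1) m (v, 2) := not_before_head (hJ.woman_one v)

theorem not_woman_two_top (hJ : IsGadget E J) {v : Fin p} {m : Fin p × ℕ} :
    ¬ J.WomanPrefers (v, 2) m (v, 1) := not_before_head (hJ.woman_two v)

theorem ne_of_edge (hJ : IsGadget E J) {u v : Fin p} (h : (u, v) ∈ E) : u ≠ v := by
  rintro rfl
  exact Before.irrefl (hJ.woman_one_before_iff.2 (.inr ⟨u, h, rfl⟩))

theorem acceptable_of_mem (hJ : IsGadget E J) {m w : Fin p × ℕ} (hm : m.2 = 1 ∨ m.2 = 2)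
    (hw : w ∈ J.manPref m) : J.Acceptable m w := by
  have hm' := (hJ.mem_men m).2 hm
  have hw' := hJ.man_mem _ hm' _ hw
  exact ⟨hm', hw', hw, (hJ.consistent _ hm' _ hw').1 hw⟩

theorem acceptable_one_one (hJ : IsGadget E J) (v : Fin p) : J.Acceptable (v, 1) (v, 1) :=
  hJ.acceptable_of_mem (.inl rfl) ((hJ.man_one v).subset (by simp))

theorem acceptable_one_two (hJ : IsGadget E J) (v : Fin p) : J.Acceptable (v, 1) (v, 2) :=
  hJ.acceptable_of_mem (.inl rfl) ((hJ.man_one v).subset (by simp))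

theorem acceptable_two_one (hJ : IsGadget E J) (v : Fin p) : J.Acceptable (v, 2) (v, 1) :=
  hJ.acceptable_of_mem (.inr rfl) ((hJ.man_two v).subset (by simp))

theorem acceptable_two_two (hJ : IsGadget E J) (v : Fin p) : J.Acceptable (v, 2) (v, 2) :=
  hJ.acceptable_of_mem (.inr rfl) ((hJ.man_two v).subset (by simp))

theorem acceptable_edge (hJ : IsGadget E J) {u v : Fin p} (h : (u, v) ∈ E) :
    J.Acceptable (v, 1) (u, 1) :=
  hJ.acceptable_of_mem (.inl rfl) ((hJ.man_one v).subset (by simp [h]))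

end IsGadget

/-! ### Stable matchings and sets of vertices closed under predecessors -/

/-- The set `S` of vertices is closed under predecessors along the edges. -/
def PredClosed (E : List (Fin p × Fin p)) (S : Set (Fin p)) : Prop :=
  ∀ u v, (u, v) ∈ E → v ∈ S → u ∈ S

/-- The matching in which `m_{1,v}` and `m_{2,v}` have the partners `w_{2,v}` and `w_{1,v}` if
`v ∈ S`, and the partners `w_{1,v}` and `w_{2,v}` otherwise. -/
def matchOf (S : Set (Fin p)) : Set ((Fin p × ℕ) × (Fin p × ℕ)) :=
  {x | ∃ v, (v ∉ S ∧ (x = ((v, 1), (v, 1)) ∨ x = ((v, 2), (v, 2)))) ∨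
    (v ∈ S ∧ (x = ((v, 1), (v, 2)) ∨ x = ((v, 2), (v, 1))))}

section matchOf

variable {S : Set (Fin p)}

theorem mem_matchOf_iff {m w : Fin p × ℕ} : (m, w) ∈ matchOf S ↔ ∃ v,
    (v ∉ S ∧ (m = (v, 1) ∧ w = (v, 1) ∨ m = (v, 2) ∧ w = (v, 2))) ∨
    (v ∈ S ∧ (m = (v, 1) ∧ w = (v, 2) ∨ m = (v, 2) ∧ w = (v, 1))) := by
  simp only [matchOf, Set.mem_ofPred_eq, Prod.ext_iff]

theorem one_one_mem_matchOf {v : Fin p} : ((v, 1), (v, 1)) ∈ matchOf S ↔ v ∉ S := by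
  simp [matchOf]

theorem two_two_mem_matchOf {v : Fin p} : ((v, 2), (v, 2)) ∈ matchOf S ↔ v ∉ S := by
  simp [matchOf]

theorem one_two_mem_matchOf {v : Fin p} : ((v, 1), (v, 2)) ∈ matchOf S ↔ v ∈ S := by
  simp [matchOf]

theorem two_one_mem_matchOf {v : Fin p} : ((v, 2), (v, 1)) ∈ matchOf S ↔ v ∈ S := by
  simp [matchOf]

theorem matchOf_injective : Function.Injective (matchOf : Set (Fin p) → _) := by
  intro S T h
  ext v
  rw [← two_one_mem_matchOf, h, two_one_mem_matchOf]

/-- Every man has a partner, unique and given by his vertex and number. -/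
theorem man_mem_matchOf {v : Fin p} {w : Fin p × ℕ} :
    (((v, 1), w) ∈ matchOf S ↔ (v ∉ S ∧ w = (v, 1)) ∨ (v ∈ S ∧ w = (v, 2))) ∧
    (((v, 2), w) ∈ matchOf S ↔ (v ∉ S ∧ w = (v, 2)) ∨ (v ∈ S ∧ w = (v, 1))) := by
  constructor <;> rw [mem_matchOf_iff] <;> constructor
  · rintro ⟨x, ⟨h, h'⟩ | ⟨h, h'⟩⟩ <;> simp at h' <;> obtain ⟨rfl, rfl⟩ := h' <;> simp [h]
  · rintro (⟨h, rfl⟩ | ⟨h, rfl⟩) <;> exact ⟨v, by simp [h]⟩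
  · rintro ⟨x, ⟨h, h'⟩ | ⟨h, h'⟩⟩ <;> simp at h' <;> obtain ⟨rfl, rfl⟩ := h' <;> simp [h]
  · rintro (⟨h, rfl⟩ | ⟨h, rfl⟩) <;> exact ⟨v, by simp [h]⟩

theorem woman_mem_matchOf {v : Fin p} {m : Fin p × ℕ} :
    ((m, (v, 1)) ∈ matchOf S ↔ (v ∉ S ∧ m = (v, 1)) ∨ (v ∈ S ∧ m = (v, 2))) ∧
    ((m, (v, 2)) ∈ matchOf S ↔ (v ∉ S ∧ m = (v, 2)) ∨ (v ∈ S ∧ m = (v, 1))) := by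
  constructor <;> rw [mem_matchOf_iff] <;> constructor
  · rintro ⟨x, ⟨h, h'⟩ | ⟨h, h'⟩⟩ <;> simp at h' <;> obtain ⟨rfl, rfl⟩ := h' <;> simp [h]
  · rintro (⟨h, rfl⟩ | ⟨h, rfl⟩) <;> exact ⟨v, by simp [h]⟩
  · rintro ⟨x, ⟨h, h'⟩ | ⟨h, h'⟩⟩ <;> simp at h' <;> obtain ⟨rfl, rfl⟩ := h' <;> simp [h]
  · rintro (⟨h, rfl⟩ | ⟨h, rfl⟩) <;> exact ⟨v, by simp [h]⟩

end matchOf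

/-- The rotation of the vertex `v`, which exchanges the partners of `m_{1,v}` and `m_{2,v}`. -/
def rot (v : Fin p) : Cycle ((Fin p × ℕ) × (Fin p × ℕ)) :=
  (([((v, 1), (v, 1)), ((v, 2), (v, 2))] : List ((Fin p × ℕ) × (Fin p × ℕ))) : Cycle _)

theorem mem_rot {v : Fin p} {x : (Fin p × ℕ) × (Fin p × ℕ)} :
    x ∈ rot v ↔ x = ((v, 1), (v, 1)) ∨ x = ((v, 2), (v, 2)) := by
  simp [rot]

theorem rot_injective : Function.Injective (rot : Fin p → _) := by
  intro u v h
  have h1 : ((u, 1), (u, 1)) ∈ rot v := h ▸ mem_rot.2 (.inl rfl)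
  simpa [mem_rot] using h1

theorem eliminate_matchOf {S : Set (Fin p)} {v : Fin p} (hv : v ∉ S) :
    eliminate (matchOf S) (rot v) = matchOf (insert v S) := by
  have hne : ∀ u ∈ S, u ≠ v := by
    rintro u hu rfl
    exact hv hu
  ext ⟨m, w⟩
  simp only [eliminate, Set.mem_union, Set.mem_ofPred_eq, mem_rot, mem_matchOf_iff]
  constructor
  · rintro (⟨⟨u, ⟨hu, h⟩ | ⟨hu, h⟩⟩, hx⟩ | ⟨x, y, hxy, h⟩)
    · refine ⟨u, .inl ⟨?_, h⟩⟩
      rintro (rfl | h')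
      · rcases h with ⟨rfl, rfl⟩ | ⟨rfl, rfl⟩ <;> simp at hx
      · exact hu h'
    · exact ⟨u, .inr ⟨.inr hu, h⟩⟩
    · rw [rot, follows_pair_iff] at hxy
      refine ⟨v, .inr ⟨.inl rfl, ?_⟩⟩
      rcases hxy with ⟨rfl, rfl⟩ | ⟨rfl, rfl⟩
      · exact .inl (Prod.ext_iff.1 h)
      · exact .inr (Prod.ext_iff.1 h)
  · rintro ⟨u, ⟨hu, h⟩ | ⟨hu, h⟩⟩
    · have huv : u ≠ v := fun h => hu (.inl h)
      refine .inl ⟨⟨u, .inl ⟨fun h => hu (.inr h), h⟩⟩, ?_⟩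
      rcases h with ⟨rfl, rfl⟩ | ⟨rfl, rfl⟩ <;> simp [huv]
    · rcases hu with rfl | hu
      · right
        rcases h with ⟨rfl, rfl⟩ | ⟨rfl, rfl⟩
        · exact ⟨_, _, follows_pair_iff.2 (.inl ⟨rfl, rfl⟩), rfl⟩
        · exact ⟨_, _, follows_pair_iff.2 (.inr ⟨rfl, rfl⟩), rfl⟩
      · refine .inl ⟨⟨u, .inr ⟨hu, h⟩⟩, ?_⟩
        rcases h with ⟨rfl, rfl⟩ | ⟨rfl, rfl⟩ <;> simp

/-- A man whom the woman `w` ranks first has at worst the partner `w` in a stable matching. -/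
theorem woman_top_of_isStable {A B : Type*} [DecidableEq A] [DecidableEq B] {I : Instance A B}
    {μ : Set (A × B)} (hμ : I.IsStable μ) {m : A} {w : B} (ha : I.Acceptable m w)
    (ht : ∀ m', ¬ I.WomanPrefers w m' m) : ∃ w', (m, w') ∈ μ ∧ (w' = w ∨ I.ManPrefers m w' w) := by
  by_contra! hc
  apply hμ.2 m w
  refine ⟨ha, fun w' hw' => ?_, fun m' hm' => ?_⟩
  · have := hc w' hw'
    rcases Before.trichotomy (hμ.1.1 _ _ hw').2.2.1 ha.2.2.1 with h | h | h
    · exact absurd h this.1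
    · exact absurd h this.2
    · exact h
  · rcases Before.trichotomy ha.2.2.2 (hμ.1.1 _ _ hm').2.2.2 with h | h | h
    · subst h
      exact absurd rfl (hc w hm').1
    · exact h
    · exact absurd h (ht m')

/-- A woman whom the man `m` ranks first has at worst the partner `m` in a stable matching. -/
theorem man_top_of_isStable {A B : Type*} [DecidableEq A] [DecidableEq B] {I : Instance A B}
    {μ : Set (A × B)} (hμ : I.IsStable μ) {m : A} {w : B} (ha : I.Acceptable m w)
    (ht : ∀ w', ¬ I.ManPrefers m w' w) :
    ∃ m', (m', w) ∈ μ ∧ (m' = m ∨ I.WomanPrefers w m' m) := by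
  by_contra! hc
  apply hμ.2 m w
  refine ⟨ha, fun w' hw' => ?_, fun m' hm' => ?_⟩
  · rcases Before.trichotomy ha.2.2.1 (hμ.1.1 _ _ hw').2.2.1 with h | h | h
    · subst h
      exact absurd rfl (hc m hw').1
    · exact h
    · exact absurd h (ht w')
  · have := hc m' hm'
    rcases Before.trichotomy (hμ.1.1 _ _ hm').2.2.2 ha.2.2.2 with h | h | h
    · exact absurd h this.1
    · exact absurd h this.2
    · exact h

namespace IsGadget

theorem isStable_matchOf (hJ : IsGadget E J) {S : Set (Fin p)} (hS : PredClosed E S) :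
    J.IsStable (matchOf S) := by
  refine ⟨⟨?_, ?_, ?_⟩, ?_⟩
  · intro m w h
    obtain ⟨v, ⟨_, h⟩ | ⟨_, h⟩⟩ := mem_matchOf_iff.1 h
    · rcases h with ⟨rfl, rfl⟩ | ⟨rfl, rfl⟩
      exacts [hJ.acceptable_one_one v, hJ.acceptable_two_two v]
    · rcases h with ⟨rfl, rfl⟩ | ⟨rfl, rfl⟩
      exacts [hJ.acceptable_one_two v, hJ.acceptable_two_one v]
  · intro m w w' h h'
    obtain ⟨v, ⟨hv, ⟨rfl, rfl⟩ | ⟨rfl, rfl⟩⟩ | ⟨hv, ⟨rfl, rfl⟩ | ⟨rfl, rfl⟩⟩⟩ := mem_matchOf_iff.1 h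
    all_goals simpa [man_mem_matchOf, hv, eq_comm] using h'
  · intro m m' w h h'
    obtain ⟨v, ⟨hv, ⟨rfl, rfl⟩ | ⟨rfl, rfl⟩⟩ | ⟨hv, ⟨rfl, rfl⟩ | ⟨rfl, rfl⟩⟩⟩ := mem_matchOf_iff.1 h
    all_goals simpa [woman_mem_matchOf, hv, eq_comm] using h'
  · rintro ⟨v, c⟩ w ⟨ha, hm, hw⟩
    rcases (hJ.mem_men _).1 ha.1 with h | h <;> dsimp only at h <;> subst h
    · by_cases hv : v ∈ S
      · rcases hJ.man_one_before_iff.1 (hm _ (one_two_mem_matchOf.2 hv)) with rfl | ⟨u, hu, rfl⟩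
        · exact hJ.not_woman_one_top (hw _ (two_one_mem_matchOf.2 hv))
        · exact hJ.not_woman_one_top (hw _ (two_one_mem_matchOf.2 (hS u v hu hv)))
      · exact hJ.not_man_one_top (hm _ (one_one_mem_matchOf.2 hv))
    · by_cases hv : v ∈ S
      · have := hJ.man_two_before_iff.1 (hm _ (two_one_mem_matchOf.2 hv))
        subst this
        exact hJ.not_woman_two_top (hw _ (one_two_mem_matchOf.2 hv))
      · exact hJ.not_man_two_top (hm _ (two_two_mem_matchOf.2 hv))

/-- Every man has at worst the woman who ranks him first, and every woman at worst the man who ranks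
her first, so that only pairs of the constructed lists occur. A man `m_{1,v}` with `v ∉ S` then has
a partner `w_{1,u}` with `u = v` or `(u, v) ∈ E`, and induction along the order gives `u = v`. -/
theorem exists_eq_matchOf (hJ : IsGadget E J) {α : Type*} [PartialOrder α] {e : Fin p ≃ α}
    (hE : IsHasseEdgeList e E) {μ : Set ((Fin p × ℕ) × (Fin p × ℕ))} (hμ : J.IsStable μ) :
    ∃ S, PredClosed E S ∧ μ = matchOf S := by
  have hm := hμ.1.2.1
  have hw := hμ.1.2.2
  set S : Set (Fin p) := {v | ((v, 2), (v, 1)) ∈ μ} with hS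
  have h12 : ∀ v ∈ S, ((v, 1), (v, 2)) ∈ μ := by
    intro v hv
    obtain ⟨m, hmμ, h⟩ := man_top_of_isStable hμ (hJ.acceptable_two_two v)
      (fun _ => hJ.not_man_two_top)
    rw [hJ.woman_two_before_iff] at h
    rcases h with rfl | rfl
    · simpa using hm _ _ _ hmμ hv
    · exact hmμ
  have h22 : ∀ v ∉ S, ((v, 2), (v, 2)) ∈ μ := by
    intro v hv
    obtain ⟨w, hwμ, h⟩ := woman_top_of_isStable hμ (hJ.acceptable_two_one v)
      (fun _ => hJ.not_woman_one_top)
    rw [hJ.man_two_before_iff] at h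
    rcases h with rfl | rfl
    · exact absurd hwμ hv
    · exact hwμ
  have : Finite α := Finite.of_equiv _ e
  have hwf : WellFounded (fun u v : Fin p => e u < e v) := InvImage.wf e wellFounded_lt
  have h11 : ∀ v ∉ S, ((v, 1), (v, 1)) ∈ μ := by
    intro v
    induction v using hwf.induction with | _ v ih =>
    intro hv
    obtain ⟨w, hwμ, h⟩ := woman_top_of_isStable hμ (hJ.acceptable_one_two v)
      (fun _ => hJ.not_woman_two_top)
    rw [hJ.man_one_before_iff] at h
    rcases h with rfl | rfl | ⟨u, hu, rfl⟩
    · simpa using hw _ _ _ hwμ (h22 v hv)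
    · exact hwμ
    · by_cases huS : u ∈ S
      · simpa using hw _ _ _ hwμ huS
      · have := hw _ _ _ hwμ (ih u ((hE.2 u v).1 hu).lt huS)
        simp only [Prod.mk.injEq, and_true] at this
        subst this
        exact hwμ
  refine ⟨S, ?_, ?_⟩
  · intro u v huv hv
    by_contra hu
    apply hμ.2 (v, 1) (u, 1)
    refine ⟨hJ.acceptable_edge huv, fun w' hw' => ?_, fun m' hm' => ?_⟩
    · rw [← hm _ _ _ (h12 v hv) hw']
      exact hJ.man_one_before_iff.2 (.inr ⟨u, huv, rfl⟩)
    · rw [← hw _ _ _ (h11 u hu) hm']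
      exact hJ.woman_one_before_iff.2 (.inr ⟨v, huv, rfl⟩)
  · have hsub : matchOf S ⊆ μ := by
      rintro ⟨m, w⟩ h
      obtain ⟨v, ⟨hv, ⟨rfl, rfl⟩ | ⟨rfl, rfl⟩⟩ | ⟨hv, ⟨rfl, rfl⟩ | ⟨rfl, rfl⟩⟩⟩ :=
        mem_matchOf_iff.1 h
      exacts [h11 v hv, h22 v hv, h12 v hv, hv]
    refine Set.Subset.antisymm ?_ hsub
    rintro ⟨⟨v, c⟩, w⟩ h
    rcases (hJ.mem_men _).1 (hμ.1.1 _ _ h).1 with hc | hc <;> dsimp only at hc <;> subst hc <;>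
      by_cases hv : v ∈ S
    · rw [hm _ _ _ h (h12 v hv)]
      exact one_two_mem_matchOf.2 hv
    · rw [hm _ _ _ h (h11 v hv)]
      exact one_one_mem_matchOf.2 hv
    · rw [hm _ _ _ h hv]
      exact two_one_mem_matchOf.2 hv
    · rw [hm _ _ _ h (h22 v hv)]
      exact two_two_mem_matchOf.2 hv

theorem isSMInstance (hJ : IsGadget E J) {α : Type*} [PartialOrder α] {e : Fin p ≃ α}
    (hE : IsHasseEdgeList e E) : J.IsSMInstance where
  man_nodup := hJ.man_nodup
  woman_nodup := hJ.woman_nodup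
  man_mem := hJ.man_mem
  woman_mem := hJ.woman_mem
  consistent := hJ.consistent
  man_matched := by
    rintro μ hμ ⟨v, c⟩ h
    obtain ⟨S, -, rfl⟩ := hJ.exists_eq_matchOf hE hμ
    rcases (hJ.mem_men _).1 h with hc | hc <;> dsimp only at hc <;> subst hc <;>
      by_cases hv : v ∈ S
    exacts [⟨_, one_two_mem_matchOf.2 hv⟩, ⟨_, one_one_mem_matchOf.2 hv⟩,
      ⟨_, two_one_mem_matchOf.2 hv⟩, ⟨_, two_two_mem_matchOf.2 hv⟩]
  woman_matched := by
    rintro μ hμ ⟨v, c⟩ h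
    obtain ⟨S, -, rfl⟩ := hJ.exists_eq_matchOf hE hμ
    rcases (hJ.mem_women _).1 h with hc | hc <;> dsimp only at hc <;> subst hc <;>
      by_cases hv : v ∈ S
    exacts [⟨_, two_one_mem_matchOf.2 hv⟩, ⟨_, one_one_mem_matchOf.2 hv⟩,
      ⟨_, one_two_mem_matchOf.2 hv⟩, ⟨_, two_two_mem_matchOf.2 hv⟩]

/-! ### Rotations -/

/-- The pairs of a stable matching that have a next pair belong to vertices `v ∉ S`. The next pair
of `(m_{1,v}, w_{1,v})` is `(m_{2,v}, w_{2,v})` if all predecessors of `v` are in `S`, and a pair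
`(m_{1,u}, w_{1,u})` with `(u, v) ∈ E` otherwise. -/
theorem isNextPair_cases (hJ : IsGadget E J) {S : Set (Fin p)}
    {x y : (Fin p × ℕ) × (Fin p × ℕ)} (hx : x ∈ matchOf S) (h : J.IsNextPair (matchOf S) x y) :
    ∃ v ∉ S, (x = ((v, 2), (v, 2)) ∧ y = ((v, 1), (v, 1))) ∨
      (x = ((v, 1), (v, 1)) ∧
        ((y = ((v, 2), (v, 2)) ∧ ∀ u, (u, v) ∈ E → u ∈ S) ∨
          ∃ u, (u, v) ∈ E ∧ u ∉ S ∧ y = ((u, 1), (u, 1)))) := by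
  obtain ⟨m, w⟩ := x
  obtain ⟨m', w'⟩ := y
  obtain ⟨hy, hmp, hwp, hno⟩ := h
  dsimp only at hmp hwp hno
  obtain ⟨v, ⟨hv, ⟨rfl, rfl⟩ | ⟨rfl, rfl⟩⟩ | ⟨hv, h⟩⟩ := mem_matchOf_iff.1 hx
  · refine ⟨v, hv, .inr ⟨rfl, ?_⟩⟩
    rcases Before.trichotomy hmp.2.1 (hJ.acceptable_one_two v).2.2.1 with rfl | hb | hb
    · left
      rw [woman_mem_matchOf.2] at hy
      simp only [hv, not_false_eq_true, true_and, false_and, or_false] at hy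
      subst hy
      refine ⟨rfl, fun u hu => ?_⟩
      by_contra huS
      exact hno (u, 1) (hJ.man_one_top_iff.2 ⟨(hJ.acceptable_edge hu).2.2.1, by
          simpa using hJ.ne_of_edge hu⟩)
        (hJ.man_one_before_iff.2 (.inr ⟨u, hu, rfl⟩))
        ⟨(u, 1), one_one_mem_matchOf.2 huS, hJ.woman_one_before_iff.2 (.inr ⟨v, hu, rfl⟩)⟩
    · right
      rcases hJ.man_one_before_iff.1 hb with rfl | ⟨u, hu, rfl⟩
      · exact absurd hmp hJ.not_man_one_top
      · rcases woman_mem_matchOf.1.1 hy with ⟨huS, rfl⟩ | ⟨_, rfl⟩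
        · exact ⟨u, hu, huS, rfl⟩
        · exact absurd hwp hJ.not_woman_one_top
    · exfalso
      refine hno (v, 2) (hJ.man_one_before_iff.2 (.inl rfl)) hb
        ⟨(v, 2), two_two_mem_matchOf.2 hv, hJ.woman_two_before_iff.2 rfl⟩
  · refine ⟨v, hv, .inl ⟨rfl, ?_⟩⟩
    rcases Before.trichotomy hmp.2.1 (hJ.acceptable_two_one v).2.2.1 with rfl | hb | hb
    · rw [woman_mem_matchOf.1] at hy
      simp only [hv, not_false_eq_true, true_and, false_and, or_false] at hy
      rw [hy]
    · rw [hJ.man_two_before_iff.1 hb] at hmp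
      exact absurd hmp hJ.not_man_two_top
    · exfalso
      exact hno (v, 1) (hJ.man_two_before_iff.2 rfl) hb
        ⟨(v, 1), one_one_mem_matchOf.2 hv, hJ.woman_one_before_iff.2 (.inl rfl)⟩
  · exfalso
    -- The woman `w` ranks `m` first, and `w'` lies beyond the constructed list of `m`, hence `m`
    -- beyond the constructed list of `w'`, while the partner `m'` of `w'` is on that list.
    obtain ⟨u, ⟨hu, ⟨rfl, rfl⟩ | ⟨rfl, rfl⟩⟩ | ⟨hu, ⟨rfl, rfl⟩ | ⟨rfl, rfl⟩⟩⟩ :=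
      mem_matchOf_iff.1 hy
    · rcases h with ⟨rfl, rfl⟩ | ⟨rfl, rfl⟩
      · rcases hJ.woman_one_before_iff.1 hwp with h | ⟨x, hx, h⟩
        · simp at h
        · simp only [Prod.mk.injEq, and_true] at h
          subst h
          exact Before.asymm hmp (hJ.man_one_before_iff.2 (.inr ⟨u, hx, rfl⟩))
      · rcases hJ.woman_one_before_iff.1 hwp with h | ⟨x, hx, h⟩
        · simp only [Prod.mk.injEq, and_true] at h
          subst h
          exact hu hv
        · simp at h
    · have := hJ.woman_two_before_iff.1 hwp
      rcases h with ⟨rfl, rfl⟩ | ⟨rfl, rfl⟩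
      · simp only [Prod.mk.injEq, and_true] at this
        subst this
        exact hu hv
      · simp at this
    · exact hJ.not_woman_two_top hwp
    · exact hJ.not_woman_one_top hwp

theorem isExposed_rot (hJ : IsGadget E J) {S : Set (Fin p)} (hS : PredClosed E S) {v : Fin p}
    (hv : v ∉ S) (hp : ∀ u, (u, v) ∈ E → u ∈ S) : J.IsExposed (matchOf S) (rot v) := by
  refine ⟨hJ.isStable_matchOf hS, by simp [rot], by simp [rot], ?_, ?_⟩
  · intro x hx
    rcases mem_rot.1 hx with rfl | rfl
    exacts [one_one_mem_matchOf.2 hv, two_two_mem_matchOf.2 hv]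
  · intro x y hxy
    rcases follows_pair_iff.1 hxy with ⟨rfl, rfl⟩ | ⟨rfl, rfl⟩
    · refine ⟨two_two_mem_matchOf.2 hv, hJ.man_one_before_iff.2 (.inl rfl),
        hJ.woman_two_before_iff.2 rfl, ?_⟩
      rintro w h h' ⟨m, hm, hmp⟩
      rcases hJ.man_one_before_iff.1 h' with rfl | ⟨u, hu, rfl⟩
      · exact Before.irrefl h
      · rw [woman_mem_matchOf.1] at hm
        simp only [hp u hu, not_true_eq_false, false_and, true_and, false_or] at hm
        subst hm
        exact hJ.not_woman_one_top hmp
    · refine ⟨one_one_mem_matchOf.2 hv, hJ.man_two_before_iff.2 rfl,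
        hJ.woman_one_before_iff.2 (.inl rfl), ?_⟩
      rintro w h h' -
      rw [hJ.man_two_before_iff.1 h'] at h
      exact Before.irrefl h

/-- Following the next pairs of an exposed rotation never ascends. At a minimal vertex `v` of the
rotation the next pair of `(m_{1,v}, w_{1,v})` can therefore only be `(m_{2,v}, w_{2,v})`, which
closes the circle. -/
theorem exists_of_isExposed (hJ : IsGadget E J) {α : Type*} [PartialOrder α] {e : Fin p ≃ α}
    (hE : IsHasseEdgeList e E) {μ : Set ((Fin p × ℕ) × (Fin p × ℕ))}
    {ρ : Cycle ((Fin p × ℕ) × (Fin p × ℕ))} (h : J.IsExposed μ ρ) :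
    ∃ S v, PredClosed E S ∧ μ = matchOf S ∧ v ∉ S ∧ (∀ u, (u, v) ∈ E → u ∈ S) ∧ ρ = rot v := by
  obtain ⟨hμ, hne, hnd, hsub, hnext⟩ := h
  obtain ⟨S, hS, rfl⟩ := hJ.exists_eq_matchOf hE hμ
  have : Finite α := Finite.of_equiv _ e
  have hwf : WellFounded (fun u v : Fin p => e u < e v) := InvImage.wf e wellFounded_lt
  have hT : ({v | ((v, 1), (v, 1)) ∈ ρ} : Set (Fin p)).Nonempty := by
    obtain ⟨x, hx⟩ : ∃ x, x ∈ ρ := by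
      induction ρ using Cycle.induction_on with
      | nil => exact absurd rfl hne
      | cons a l _ => exact ⟨a, by simp⟩
    obtain ⟨y, hy, hxy⟩ := exists_follows hx
    obtain ⟨v, -, ⟨rfl, rfl⟩ | ⟨rfl, -⟩⟩ := hJ.isNextPair_cases (hsub x hx) (hnext x y hxy)
    exacts [⟨v, hy⟩, ⟨v, hx⟩]
  obtain ⟨v, hv, hmin⟩ := hwf.has_min _ hT
  obtain ⟨y, hy, hxy⟩ := exists_follows hv
  obtain ⟨v', hv', ⟨h, -⟩ | ⟨h, h'⟩⟩ := hJ.isNextPair_cases (hsub _ hv) (hnext _ y hxy)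
  · simp at h
  · simp only [Prod.mk.injEq, and_true, and_self] at h
    subst h
    rcases h' with ⟨rfl, hp⟩ | ⟨u, hu, -, rfl⟩
    · refine ⟨S, v, hS, rfl, hv', hp, eq_pair_of_follows hnd (by simp) hxy fun z hz => ?_⟩
      obtain ⟨x, -, ⟨h, rfl⟩ | ⟨h, -⟩⟩ := hJ.isNextPair_cases (hsub _ hy) (hnext _ z hz)
      · simp only [Prod.mk.injEq, and_true, and_self] at h
        rw [h]
      · simp at h
    · exact absurd ((hE.2 u v).1 hu).lt (hmin u hy)

theorem isManOptimal_iff (hJ : IsGadget E J) {α : Type*} [PartialOrder α] {e : Fin p ≃ α}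
    (hE : IsHasseEdgeList e E) {μ : Set ((Fin p × ℕ) × (Fin p × ℕ))} :
    J.IsManOptimal μ ↔ μ = matchOf ∅ := by
  have h0 : J.IsStable (matchOf ∅) := hJ.isStable_matchOf (fun _ _ _ h => h.elim)
  constructor
  · rintro ⟨hμ, hopt⟩
    obtain ⟨S, hS, rfl⟩ := hJ.exists_eq_matchOf hE hμ
    congr
    refine Set.eq_empty_of_forall_notMem fun v hv => ?_
    rcases hopt _ h0 (v, 2) (v, 1) (v, 2) (two_one_mem_matchOf.2 hv)
      (two_two_mem_matchOf.2 (Set.notMem_empty v)) with h | h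
    · simp at h
    · exact hJ.not_man_two_top h
  · rintro rfl
    refine ⟨h0, fun μ' hμ' m w w' h h' => ?_⟩
    have ha := hμ'.1.1 _ _ h'
    obtain ⟨v, ⟨-, ⟨rfl, rfl⟩ | ⟨rfl, rfl⟩⟩ | ⟨hv, -⟩⟩ := mem_matchOf_iff.1 h
    · exact or_iff_not_imp_left.2 fun hne => hJ.man_one_top_iff.2 ⟨ha.2.2.1, Ne.symm hne⟩
    · exact or_iff_not_imp_left.2 fun hne => hJ.man_two_top_iff.2 ⟨ha.2.2.1, Ne.symm hne⟩
    · exact hv.elim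

/-- The rotations eliminated on the way to `matchOf S` are those of the vertices of `S`, whatever the
order of elimination. -/
theorem reachedBy_iff (hJ : IsGadget E J) {α : Type*} [PartialOrder α] {e : Fin p ≃ α}
    (hE : IsHasseEdgeList e E) {μ : Set ((Fin p × ℕ) × (Fin p × ℕ))}
    {R : Set (Cycle ((Fin p × ℕ) × (Fin p × ℕ)))} :
    J.ReachedBy μ R ↔ ∃ S, PredClosed E S ∧ μ = matchOf S ∧ R = rot '' S := by
  constructor
  · intro h
    induction h with
    | start μ h => exact ⟨∅, fun _ _ _ h => h.elim, (hJ.isManOptimal_iff hE).1 h, by simp⟩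
    | step μ R ρ _ hρ ih =>
      obtain ⟨S, hS, rfl, rfl⟩ := ih
      obtain ⟨S', v, -, hSS, hv, hp, rfl⟩ := hJ.exists_of_isExposed hE hρ
      obtain rfl := matchOf_injective hSS
      refine ⟨insert v S, ?_, eliminate_matchOf hv, by rw [Set.image_insert_eq]⟩
      rintro x y hxy (rfl | hy)
      · exact .inr (hp x hxy)
      · exact .inr (hS x y hxy hy)
  · rintro ⟨S, hS, rfl, rfl⟩
    -- Remove a maximal vertex of `S` and induct on the number of vertices.
    induction hn : S.ncard generalizing S with
    | zero =>
      have : S = ∅ := (Set.ncard_eq_zero (Set.toFinite S)).1 hn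
      subst this
      rw [Set.image_empty]
      exact .start _ ((hJ.isManOptimal_iff hE).2 rfl)
    | succ n ih =>
      have : Finite α := Finite.of_equiv _ e
      have hwf : WellFounded (fun u v : Fin p => e v < e u) := InvImage.wf e wellFounded_gt
      obtain ⟨v, hv, hmax⟩ := hwf.has_min S (Set.nonempty_of_ncard_ne_zero (by omega))
      have hS' : PredClosed E (S \ {v}) := by
        rintro x y hxy ⟨hy, -⟩
        refine ⟨hS x y hxy hy, ?_⟩
        rintro rfl
        exact hmax y hy ((hE.2 _ _).1 hxy).lt
      have hvS : v ∉ S \ {v} := by simp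
      have h := ReachedBy.step _ _ _ (ih _ hS' (by
          rw [Set.ncard_sdiff_singleton_of_mem hv]
          omega))
        (hJ.isExposed_rot hS' hvS fun u hu => ⟨hS u v hu hv, hJ.ne_of_edge hu⟩)
      rwa [eliminate_matchOf hvS, ← Set.image_insert_eq, Set.insert_sdiff_singleton,
        Set.insert_eq_of_mem hv] at h

theorem mem_eliminated_iff (hJ : IsGadget E J) {α : Type*} [PartialOrder α] {e : Fin p ≃ α}
    (hE : IsHasseEdgeList e E) {S : Set (Fin p)} (hS : PredClosed E S) {u : Fin p} :
    rot u ∈ J.eliminated (matchOf S) ↔ u ∈ S := by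
  constructor
  · rintro ⟨R, hR, hu⟩
    obtain ⟨S', -, h, rfl⟩ := (hJ.reachedBy_iff hE).1 hR
    obtain rfl := matchOf_injective h
    rwa [rot_injective.mem_set_image] at hu
  · exact fun hu => ⟨rot '' S, (hJ.reachedBy_iff hE).2 ⟨S, hS, rfl, rfl⟩, Set.mem_image_of_mem _ hu⟩

end IsGadget

/-- In a finite order every relation `u ≤ v` is a chain of covering pairs, so closure along the edges
is closure under `≤`. -/
theorem mem_of_predClosed {α : Type*} [PartialOrder α] {e : Fin p ≃ α} (hE : IsHasseEdgeList e E)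
    {S : Set (Fin p)} (hS : PredClosed E S) {u v : Fin p} (huv : e u ≤ e v) (hv : v ∈ S) :
    u ∈ S := by
  classical
  have : Fintype α := Fintype.ofEquiv _ e
  have : LocallyFiniteOrder α := Fintype.toLocallyFiniteOrder
  rw [le_iff_reflTransGen_covBy] at huv
  suffices h : ∀ a b : α, Relation.ReflTransGen (· ⋖ ·) a b → e.symm b ∈ S → e.symm a ∈ S by
    simpa using h _ _ huv (by simpa using hv)
  intro a b hab hb
  induction hab with
  | refl => exact hb
  | tail _ hc ih => exact ih (hS _ _ ((hE.2 _ _).2 (by simpa using hc)) hb)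

namespace IsGadget

theorem precedes_iff (hJ : IsGadget E J) {α : Type*} [PartialOrder α] {e : Fin p ≃ α}
    (hE : IsHasseEdgeList e E) {u v : Fin p} : J.Precedes (rot u) (rot v) ↔ e u < e v := by
  constructor
  · intro h
    have hS : PredClosed E {x | e x < e v} := fun x y hxy hy => ((hE.2 x y).1 hxy).lt.trans hy
    exact (hJ.mem_eliminated_iff hE hS).1 (h _ (hJ.isExposed_rot hS (lt_irrefl _)
      fun x hx => ((hE.2 x v).1 hx).lt))
  · intro huv μ hμ
    obtain ⟨S, v', hS, rfl, hv, hp, hvv⟩ := hJ.exists_of_isExposed hE hμ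
    obtain rfl := rot_injective hvv
    refine (hJ.mem_eliminated_iff hE hS).2 ?_
    have hS' : PredClosed E (insert v S) := by
      rintro x y hxy (rfl | hy)
      · exact .inr (hp x hxy)
      · exact .inr (hS x y hxy hy)
    rcases mem_of_predClosed hE hS' huv.le (Set.mem_insert v S) with rfl | h
    · exact absurd huv (lt_irrefl _)
    · exact h

theorem rotations_eq (hJ : IsGadget E J) {α : Type*} [PartialOrder α] {e : Fin p ≃ α}
    (hE : IsHasseEdgeList e E) : J.rotations = Set.range rot := by
  ext ρ
  constructor
  · rintro ⟨μ, hμ⟩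
    obtain ⟨-, v, -, -, -, -, rfl⟩ := hJ.exists_of_isExposed hE hμ
    exact ⟨v, rfl⟩
  · rintro ⟨v, rfl⟩
    have hS : PredClosed E {x | e x < e v} := fun x y hxy hy => ((hE.2 x y).1 hxy).lt.trans hy
    exact ⟨_, hJ.isExposed_rot hS (lt_irrefl _) fun x hx => ((hE.2 x v).1 hx).lt⟩

theorem realizes (hJ : IsGadget E J) {α : Type*} [PartialOrder α] {e : Fin p ≃ α}
    (hE : IsHasseEdgeList e E) : J.Realizes α := by
  rw [Realizes, hJ.rotations_eq hE]
  refine ⟨e.symm.trans (Equiv.ofInjective rot rot_injective), fun x y => ?_⟩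
  simp [hJ.precedes_iff hE]

end IsGadget

/-! ### The constructed instance and its completions -/

theorem colorSet_one (E : List (Fin p × Fin p)) (v : Fin p) :
    colorSet E (fun _ => 1) v = {1, 2} := by
  unfold colorSet
  dsimp only
  generalize E.filter (fun e => decide (e.1 = v ∨ e.2 = v)) = l
  rcases l with _ | ⟨a, l⟩
  · simp
  · rw [List.map_const', List.length_cons, List.toFinset_replicate_of_ne_zero (Nat.succ_ne_zero _)]
    decide

theorem colorList_one (E : List (Fin p × Fin p)) (v : Fin p) :
    colorList E (fun _ => 1) v = [1, 2] := by
  have h : (({1, 2} : Finset ℕ)) = [1, 2].toFinset := by decide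
  rw [colorList, colorSet_one, h]
  exact (List.toFinset_sort (r := (· ≤ ·)) (by decide)).2 (by simp)

theorem agentList_one (E : List (Fin p × Fin p)) :
    agentList E (fun _ => 1) = (List.finRange p).flatMap (fun v => [(v, 1), (v, 2)]) := by
  simp [agentList, colorList_one]

theorem mem_agentList {a : Fin p × ℕ} :
    a ∈ agentList E (fun _ => 1) ↔ a.2 = 1 ∨ a.2 = 2 := by
  obtain ⟨v, c⟩ := a
  simp [agentList_one, exists_or]

theorem nodup_agentList : (agentList E (fun _ => 1)).Nodup := by
  rw [agentList_one, List.nodup_flatMap]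
  refine ⟨by simp, (List.nodup_finRange p).imp fun h => ?_⟩
  simp [List.disjoint_left, h]

theorem length_agentList : (agentList E (fun _ => 1)).length = 2 * p := by
  simp [agentList_one, mul_comm]

theorem manPref_one (v : Fin p) : (constructInstance E (fun _ => 1)).manPref (v, 1) =
    (v, 1) :: ((E.filter (fun e => e.2 = v)).map (fun e => (e.1, 1)) ++ [(v, 2)]) := by
  simp [constructInstance, nextColor, colorList_one]

theorem manPref_two (v : Fin p) : (constructInstance E (fun _ => 1)).manPref (v, 2) =
    [(v, 2), (v, 1)] := by
  simp [constructInstance, nextColor, colorList_one]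

theorem womanPref_one (v : Fin p) : (constructInstance E (fun _ => 1)).womanPref (v, 1) =
    (v, 2) :: ((E.filter (fun e => e.1 = v)).reverse.map (fun e => (e.2, 1)) ++ [(v, 1)]) := by
  simp [constructInstance, prevColor, colorList_one]

theorem womanPref_two (v : Fin p) : (constructInstance E (fun _ => 1)).womanPref (v, 2) =
    [(v, 1), (v, 2)] := by
  simp [constructInstance, prevColor, colorList_one]

theorem mem_men {a : Fin p × ℕ} :
    a ∈ (constructInstance E (fun _ => 1)).men ↔ a.2 = 1 ∨ a.2 = 2 :=
  List.mem_toFinset.trans mem_agentList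

theorem mem_women {a : Fin p × ℕ} :
    a ∈ (constructInstance E (fun _ => 1)).women ↔ a.2 = 1 ∨ a.2 = 2 :=
  List.mem_toFinset.trans mem_agentList

theorem nodup_manPref (hE : E.Nodup) (hirr : ∀ v, (v, v) ∉ E) {m : Fin p × ℕ}
    (hm : m ∈ (constructInstance E (fun _ => 1)).men) :
    ((constructInstance E (fun _ => 1)).manPref m).Nodup := by
  obtain ⟨v, c⟩ := m
  rcases mem_men.1 hm with h | h <;> dsimp only at h <;> subst h
  · rw [manPref_one]
    have : ((E.filter (fun e => e.2 = v)).map (fun e => (e.1, 1))).Nodup := by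
      refine (hE.filter _).map_on ?_
      rintro ⟨a, b⟩ h ⟨a', b'⟩ h' heq
      simp at h h' heq
      simp [h, h', heq]
    simp only [List.nodup_cons, List.nodup_append, this, List.mem_append, not_or]
    simp [hirr]
  · simp [manPref_two]

theorem nodup_womanPref (hE : E.Nodup) (hirr : ∀ v, (v, v) ∉ E) {w : Fin p × ℕ}
    (hw : w ∈ (constructInstance E (fun _ => 1)).women) :
    ((constructInstance E (fun _ => 1)).womanPref w).Nodup := by
  obtain ⟨v, c⟩ := w
  rcases mem_women.1 hw with h | h <;> dsimp only at h <;> subst h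
  · rw [womanPref_one]
    have : ((E.filter (fun e => e.1 = v)).reverse.map (fun e => (e.2, 1))).Nodup := by
      refine (List.nodup_reverse.2 (hE.filter _)).map_on ?_
      rintro ⟨a, b⟩ h ⟨a', b'⟩ h' heq
      simp at h h' heq
      simp [h, h', heq]
    simp only [List.nodup_cons, List.nodup_append, this, List.mem_append, not_or]
    simp
    rintro a ha rfl
    exact hirr _ ha
  · simp [womanPref_two]

theorem mem_manPref {v w : Fin p} {c d : ℕ} (hc : c = 1 ∨ c = 2) :
    (w, d) ∈ (constructInstance E (fun _ => 1)).manPref (v, c) ↔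
      (w = v ∧ (d = 1 ∨ d = 2)) ∨ (c = 1 ∧ d = 1 ∧ (w, v) ∈ E) := by
  rcases hc with rfl | rfl
  · simp [manPref_one]
    grind
  · simp [manPref_two]
    grind

theorem mem_womanPref {v w : Fin p} {c d : ℕ} (hc : c = 1 ∨ c = 2) :
    (w, d) ∈ (constructInstance E (fun _ => 1)).womanPref (v, c) ↔
      (w = v ∧ (d = 1 ∨ d = 2)) ∨ (c = 1 ∧ d = 1 ∧ (v, w) ∈ E) := by
  rcases hc with rfl | rfl
  · simp [womanPref_one]
    grind
  · simp [womanPref_two, and_or_left]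

theorem isGadget_constructInstance (hE : E.Nodup) (hirr : ∀ v, (v, v) ∉ E) :
    IsGadget E (constructInstance E (fun _ => 1)) where
  mem_men _ := mem_men
  mem_women _ := mem_women
  man_one v := by simp [manPref_one]
  man_two v := by simp [manPref_two]
  woman_one v := by simp [womanPref_one]
  woman_two v := by simp [womanPref_two]
  man_nodup _ := nodup_manPref hE hirr
  woman_nodup _ := nodup_womanPref hE hirr
  man_mem := by
    rintro ⟨v, c⟩ hm ⟨w, d⟩ hw
    rw [mem_manPref (mem_men.1 hm)] at hw
    rw [mem_women]
    dsimp only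
    tauto
  woman_mem := by
    rintro ⟨v, c⟩ hm ⟨w, d⟩ hw
    rw [mem_womanPref (mem_women.1 hm)] at hw
    rw [mem_men]
    dsimp only
    tauto
  consistent := by
    rintro ⟨v, c⟩ hm ⟨w, d⟩ hw
    have hc := mem_men.1 hm
    have hd := mem_women.1 hw
    rw [mem_manPref hc, mem_womanPref hd]
    dsimp only at hc hd
    rw [eq_comm (a := w)]
    tauto

theorem isGadget_of_isCompletion (h : J.IsCompletion (constructInstance E (fun _ => 1))) :
    IsGadget E J := by
  obtain ⟨hmen, hwomen, hm, hw⟩ := h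
  have h1 : ∀ v : Fin p, (v, 1) ∈ (constructInstance E (fun _ => 1)).men := by simp [mem_men]
  have h2 : ∀ v : Fin p, (v, 2) ∈ (constructInstance E (fun _ => 1)).men := by simp [mem_men]
  have h1' : ∀ v : Fin p, (v, 1) ∈ (constructInstance E (fun _ => 1)).women := by simp [mem_women]
  have h2' : ∀ v : Fin p, (v, 2) ∈ (constructInstance E (fun _ => 1)).women := by simp [mem_women]
  exact
    { mem_men := fun _ => hmen ▸ mem_men
      mem_women := fun _ => hwomen ▸ mem_women
      man_one := fun v => by simpa [manPref_one] using (hm _ (h1 v)).1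
      man_two := fun v => by simpa [manPref_two] using (hm _ (h2 v)).1
      woman_one := fun v => by simpa [womanPref_one] using (hw _ (h1' v)).1
      woman_two := fun v => by simpa [womanPref_two] using (hw _ (h2' v)).1
      man_nodup := fun m h => (hm m (hmen ▸ h)).2.1
      woman_nodup := fun w h => (hw w (hwomen ▸ h)).2.1
      man_mem := fun m h w h' => hwomen ▸ ((hm m (hmen ▸ h)).2.2 w).1 h'
      woman_mem := fun w h m h' => hmen ▸ ((hw w (hwomen ▸ h)).2.2 m).1 h'
      consistent := fun m h w h' => iff_of_true (((hm m (hmen ▸ h)).2.2 w).2 (hwomen ▸ h'))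
        (((hw w (hwomen ▸ h')).2.2 m).2 (hmen ▸ h)) }

theorem hasSize_constructInstance : (constructInstance E (fun _ => 1)).HasSize (2 * p) := by
  have h : (agentList E (fun _ => 1)).toFinset.card = 2 * p := by
    rw [List.toFinset_card_of_nodup nodup_agentList, length_agentList]
  exact ⟨h, h⟩

theorem isCompletion_complete (hI : IsGadget E (constructInstance E (fun _ => 1))) :
    ((constructInstance E (fun _ => 1)).complete (agentList E (fun _ => 1))
      (agentList E (fun _ => 1))).IsCompletion (constructInstance E (fun _ => 1)) := by
  refine ⟨rfl, rfl, fun m hm => ⟨List.prefix_append _ _, ?_, fun w => ?_⟩,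
    fun w hw => ⟨List.prefix_append _ _, ?_, fun m => ?_⟩⟩
  · refine List.nodup_append.2 ⟨hI.man_nodup m hm, nodup_agentList.filter _, ?_⟩
    rintro a ha b hb rfl
    simp [ha] at hb
  · have := hI.man_mem m hm w
    rw [hI.mem_women, ← mem_agentList (E := E)] at this
    rw [hI.mem_women, ← mem_agentList (E := E)]
    simp only [complete, List.mem_append, List.mem_filter, decide_eq_true_eq]
    tauto
  · refine List.nodup_append.2 ⟨hI.woman_nodup w hw, nodup_agentList.filter _, ?_⟩
    rintro a ha b hb rfl
    simp [ha] at hb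
  · have := hI.woman_mem w hw m
    rw [hI.mem_men, ← mem_agentList (E := E)] at this
    rw [hI.mem_men, ← mem_agentList (E := E)]
    simp only [complete, List.mem_append, List.mem_filter, decide_eq_true_eq]
    tauto

/-! ### Straight-line programs -/

namespace Prog

/-- The effect of a program without branches and loops. -/
def eval : Prog → State → State
  | const r k, s => { s with reg := Function.update s.reg r k }
  | add r a b, s => { s with reg := Function.update s.reg r (s.reg a + s.reg b) }
  | sub r a b, s => { s with reg := Function.update s.reg r (s.reg a - s.reg b) }
  | load r a, s => { s with reg := Function.update s.reg r (s.mem (s.reg a)) }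
  | store a b, s => { s with mem := Function.update s.mem (s.reg a) (s.reg b) }
  | emit r, s => { s with out := s.out ++ [s.reg r] }
  | seq c d, s => d.eval (c.eval s)
  | skip, s => s
  | ite _ _ _, s => s
  | .while _ _, s => s

/-- The program has neither branches nor loops, and all its results fit into words that hold
`0, …, N`. -/
def Fits (N : ℕ) : Prog → State → Prop
  | const _ k, _ => k ≤ N
  | add _ a b, s => s.reg a + s.reg b ≤ N
  | seq c d, s => c.Fits N s ∧ d.Fits N (c.eval s)
  | ite _ _ _, _ => False
  | .while _ _, _ => False
  | _, _ => True

/-- The number of instructions of a program without branches and loops. -/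
def size : Prog → ℕ
  | seq c d => c.size + d.size
  | _ => 1

theorem exec_eval {N : ℕ} {c : Prog} {s : State} (h : c.Fits N s) :
    Exec N c s (c.eval s) c.size := by
  induction c generalizing s with
  | skip => exact .skip s
  | const r k => exact .const s r k h
  | add r a b => exact .add s r a b h
  | sub r a b => exact .sub s r a b
  | load r a => exact .load s r a
  | store a b => exact .store s a b
  | emit r => exact .emit s r
  | seq c d ihc ihd => exact .seq (ihc h.1) (ihd h.2)
  | _ => exact h.elim

/-- Execute the programs of a list one after the other. -/
def block : List Prog → Prog
  | [] => skip
  | [c] => c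
  | c :: d :: l => seq c (block (d :: l))

end Prog

open Prog

/-! ### Linked lists in the memory -/

/-- At the address `a` starts a linked list with the entries `l`, all of whose nodes lie between
`lo` and `hi`. A node occupies two cells, the entry and the address of the next node; the end of the
list is marked by the address `0`. -/
def Linked (mem : ℕ → ℕ) (lo hi : ℕ) : ℕ → List ℕ → Prop
  | a, [] => a = 0
  | a, w :: l => a ≠ 0 ∧ lo ≤ a ∧ a + 1 < hi ∧ mem a = w ∧ Linked mem lo hi (mem (a + 1)) l

theorem Linked.mono {mem mem' : ℕ → ℕ} {lo hi hi' a : ℕ} {l : List ℕ} (h : Linked mem lo hi a l)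
    (hh : hi ≤ hi') (hm : ∀ x, lo ≤ x → x < hi → mem' x = mem x) : Linked mem' lo hi' a l := by
  induction l generalizing a with
  | nil => exact h
  | cons w l ih =>
    obtain ⟨h0, h1, h2, h3, h4⟩ := h
    refine ⟨h0, h1, by omega, by rw [hm _ h1 (by omega), h3], ?_⟩
    rw [hm _ (by omega) h2]
    exact ih h4

/-- The values that the list `L` of pairs (key, value) assigns to the key `v`, doubled, the last one
first. The agent `(v, 1)` has the number `2 * v`, which is why values are doubled. -/
def bucket (L : List (ℕ × ℕ)) (v : ℕ) : List ℕ :=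
  (L.filter (fun e => e.1 = v)).reverse.map (fun e => 2 * e.2)

theorem bucket_append_singleton (L : List (ℕ × ℕ)) (e : ℕ × ℕ) (v : ℕ) :
    bucket (L ++ [e]) v = if e.1 = v then 2 * e.2 :: bucket L v else bucket L v := by
  by_cases h : e.1 = v <;> simp [bucket, h]

/-- The total length of the buckets, and with it the time for writing them out, is linear in the
number of pairs. -/
theorem sum_length_bucket (L : List (ℕ × ℕ)) (p : ℕ) :
    ((List.range p).map (fun v => (bucket L v).length)).sum ≤ L.length := by
  induction L with
  | nil => simp [bucket]
  | cons e L ih =>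
    have h : ∀ v, (bucket (e :: L) v).length = (if e.1 = v then 1 else 0) + (bucket L v).length := by
      intro v
      by_cases h : e.1 = v <;> simp [bucket, h, add_comm]
    have h1 : ((List.range p).map (fun v => if e.1 = v then 1 else 0)).sum ≤ 1 := by
      rw [← List.sum_toFinset _ List.nodup_range]
      simp only [Finset.sum_ite_eq]
      split_ifs <;> simp
    simp only [h, List.sum_map_add, List.length_cons]
    omega

/-- The table at the address `D` holds for every key `v < p` the address of a linked list of
`bucket L v` and the length of this list. The nodes lie between the end of the table and `fp`. -/
def IsTable (mem : ℕ → ℕ) (p D fp : ℕ) (L : List (ℕ × ℕ)) : Prop :=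
  ∀ v < p, Linked mem (D + 2 * p) fp (mem (D + 2 * v)) (bucket L v) ∧
    mem (D + 2 * v + 1) = (bucket L v).length

/-- The memory after the pair `(k, w)` has been inserted into the table at the address `D`, with the
new node at the address `fp`. -/
def insertMem (mem : ℕ → ℕ) (D fp k w : ℕ) : ℕ → ℕ :=
  Function.update (Function.update (Function.update (Function.update mem fp (2 * w)) (fp + 1)
    (mem (D + 2 * k))) (D + 2 * k) fp) (D + 2 * k + 1) (mem (D + 2 * k + 1) + 1)

theorem insertMem_of_lt {mem : ℕ → ℕ} {D fp k w x : ℕ} (hx : x < D) (hD : D ≤ fp) :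
    insertMem mem D fp k w x = mem x := by
  unfold insertMem
  repeat rw [Function.update_of_ne (by omega)]

theorem insertMem_of_le {mem : ℕ → ℕ} {D fp k w x : ℕ} (hx : fp + 2 ≤ x) (hD : D + 2 * k < fp) :
    insertMem mem D fp k w x = mem x := by
  unfold insertMem
  repeat rw [Function.update_of_ne (by omega)]

theorem IsTable.insert {mem : ℕ → ℕ} {p D fp k w : ℕ} {L : List (ℕ × ℕ)}
    (h : IsTable mem p D fp L) (hk : k < p) (hfp : D + 2 * p ≤ fp) :
    IsTable (insertMem mem D fp k w) p D (fp + 2) (L ++ [(k, w)]) := by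
  have hnode : ∀ x, D + 2 * p ≤ x → x < fp → insertMem mem D fp k w x = mem x := by
    intro x h1 h2
    unfold insertMem
    repeat rw [Function.update_of_ne (by omega)]
  have h1 : insertMem mem D fp k w fp = 2 * w := by
    unfold insertMem
    rw [Function.update_of_ne (by omega), Function.update_of_ne (by omega),
      Function.update_of_ne (by omega), Function.update_self]
  have h2 : insertMem mem D fp k w (fp + 1) = mem (D + 2 * k) := by
    unfold insertMem
    rw [Function.update_of_ne (by omega), Function.update_of_ne (by omega), Function.update_self]
  have h3 : insertMem mem D fp k w (D + 2 * k) = fp := by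
    unfold insertMem
    rw [Function.update_of_ne (by omega), Function.update_self]
  have h4 : insertMem mem D fp k w (D + 2 * k + 1) = mem (D + 2 * k + 1) + 1 := by
    unfold insertMem
    rw [Function.update_self]
  intro v hv
  rw [bucket_append_singleton]
  by_cases hkv : k = v
  · subst hkv
    rw [if_pos rfl, h3, h4]
    refine ⟨⟨by omega, hfp, by omega, h1, ?_⟩, ?_⟩
    · rw [h2]
      exact (h k hk).1.mono (by omega) hnode
    · rw [(h k hk).2, List.length_cons]
  · rw [if_neg hkv]
    have h5 : insertMem mem D fp k w (D + 2 * v) = mem (D + 2 * v) := by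
      unfold insertMem
      repeat rw [Function.update_of_ne (by omega)]
    have h6 : insertMem mem D fp k w (D + 2 * v + 1) = mem (D + 2 * v + 1) := by
      unfold insertMem
      repeat rw [Function.update_of_ne (by omega)]
    rw [h5, h6]
    exact ⟨(h v hv).1.mono (by omega) hnode, (h v hv).2⟩

/-! ### The program -/

/-- Insert the pair whose key and value are at the addresses `reg 11 + reg 5` and `reg 11 + reg 6`
into the table at the address `reg 4`, with the new node at the address `reg 13`. Then move on the
pointers `reg 11` and `reg 13` and count down `reg 12`. -/
def insertBody : Prog := block [add 14 11 5, load 14 14, add 16 11 6, load 16 16, add 16 16 16,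
  add 14 14 14, add 14 14 4, load 15 14, store 13 16, add 18 13 0, store 18 15, store 14 13,
  add 14 14 0, load 15 14, add 15 15 0, store 14 15, add 13 13 1, add 11 11 7, sub 11 11 8,
  sub 12 12 0]

/-- Write out the linked list at the address `reg 14`. -/
def emitList : Prog := .while 14 (block [load 16 14, emit 16, add 14 14 0, load 14 14])

/-- Write out the lists of the two agents of the vertex `v`, where `reg 17 = 2 * v` and `reg 18` is
the address of the entry of `v` in the table. -/
def emitBody : Prog :=
  .seq (block [load 14 18, add 18 18 0, load 16 18, add 18 18 0, add 16 16 1, emit 16, add 16 17 9,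
    emit 16]) (.seq emitList (block [add 16 17 10, emit 16, emit 1, emit 16, add 16 17 9, emit 16,
    add 17 17 1, sub 12 12 0]))

/-- Write out the lists of one side. The registers hold: `0, 1` the constants `1` and `2`; `2, 3`
the numbers of vertices and edges; `4` the address of the table; `5, 6` the offsets of the key and
the value of a pair; `7, 8` the increment and the decrement of the pointer to the current pair;
`9, 10` the offsets of the numbers of the first and the last entry of the list of `(v, 1)`; `11` the
address of the first pair. -/
def sideProg : Prog :=
  .seq (block [const 12 0, add 12 12 3, add 13 2 2, add 13 13 4])
    (.seq (.while 12 insertBody)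
      (.seq (block [const 12 0, add 12 12 2, const 18 0, add 18 18 4, const 17 0])
        (.while 12 emitBody)))

/-- The edges are read backwards for the men and forwards for the women, since insertion at the head
reverses the order. -/
def listProg : Prog :=
  .seq (block [const 0 1, const 1 2, load 2 14, load 3 0, add 11 3 3, add 4 11 1, const 5 1,
    const 8 2, const 10 1])
    (.seq sideProg
      (.seq (block [const 4 0, add 4 4 13, const 5 0, const 6 1, const 7 2, const 8 0, const 9 1,
        const 10 0, const 11 2])
        sideProg))

/-! ### Correctness and running time of the program -/

/-- One run of `insertBody` takes 20 steps and inserts the current pair. The hypotheses with `N` say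
that no sum exceeds the largest number in a word; `hfp` keeps the new node clear of the heads and
lengths in the table. -/
theorem exec_insertBody {N p D fp k w : ℕ} {s : State} (h0 : s.reg 0 = 1) (h1 : s.reg 1 = 2)
    (h4 : s.reg 4 = D) (h13 : s.reg 13 = fp) (hk : s.mem (s.reg 11 + s.reg 5) = k)
    (hw : s.mem (s.reg 11 + s.reg 6) = w) (hkp : k < p) (hfp : D + 2 * p ≤ fp)
    (hN : fp + 2 ≤ N) (hwN : 2 * w ≤ N) (hdeg : s.mem (D + 2 * k + 1) + 1 ≤ N)
    (hN5 : s.reg 11 + s.reg 5 ≤ N) (hN6 : s.reg 11 + s.reg 6 ≤ N) (hN7 : s.reg 11 + s.reg 7 ≤ N) :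
    ∃ s', Exec N insertBody s s' 20 ∧ s'.reg 11 = s.reg 11 + s.reg 7 - s.reg 8 ∧
      s'.reg 12 = s.reg 12 - 1 ∧ s'.reg 13 = fp + 2 ∧ (∀ r < 11, s'.reg r = s.reg r) ∧
      s'.out = s.out ∧ s'.mem = insertMem s.mem D fp k w := by
  have e1 : k + k + D = D + 2 * k := by ring
  have e2 : w + w = 2 * w := by ring
  have n1 : D + 2 * k ≠ fp := by omega
  have n3 : D + 2 * k + 1 ≠ fp := by omega
  refine ⟨insertBody.eval s, Prog.exec_eval (c := insertBody) ?_, ?_⟩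
  · simp only [insertBody, block, Fits, eval, Function.update_apply, h0, h1, h4, h13]
    simp [hk, hw, e1, e2, n1, n3]
    omega
  · simp only [insertBody, block, eval, Function.update_apply, h0, h1, h4, h13]
    simp [hk, hw, e1, e2, n1, n3, insertMem]
    intro r hr
    repeat rw [if_neg (by omega)]

/-- The pairs of the list `L` are in the memory, with their keys and values at the offsets `ko` and
`vo` from a pointer which starts at `ptr` and moves by `a - b`. All this happens below the address
`D`, and the keys and values are smaller than `p`. -/
def Reads (mem : ℕ → ℕ) (D p ko vo a b : ℕ) : ℕ → List (ℕ × ℕ) → Prop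
  | _, [] => True
  | ptr, e :: L => (ptr + ko < D ∧ ptr + vo < D ∧ e.1 < p ∧ e.2 < p) ∧
      (mem (ptr + ko) = e.1 ∧ mem (ptr + vo) = e.2) ∧ Reads mem D p ko vo a b (ptr + a - b) L

theorem Reads.congr {mem mem' : ℕ → ℕ} {D p ko vo a b ptr : ℕ} {L : List (ℕ × ℕ)}
    (h : Reads mem D p ko vo a b ptr L) (hm : ∀ x < D, mem' x = mem x) :
    Reads mem' D p ko vo a b ptr L := by
  induction L generalizing ptr with
  | nil => trivial
  | cons e L ih =>
    obtain ⟨h1, h2, h3⟩ := h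
    exact ⟨h1, by rwa [hm _ h1.1, hm _ h1.2.1], ih h3⟩

theorem length_bucket_le (L : List (ℕ × ℕ)) (v : ℕ) : (bucket L v).length ≤ L.length := by
  simpa [bucket] using List.length_filter_le _ L

theorem exec_insertLoop {N p D ko vo a b : ℕ} {L₁ L₂ : List (ℕ × ℕ)} {s : State}
    (h0 : s.reg 0 = 1) (h1 : s.reg 1 = 2) (h4 : s.reg 4 = D) (h5 : s.reg 5 = ko)
    (h6 : s.reg 6 = vo) (h7 : s.reg 7 = a) (h8 : s.reg 8 = b) (h12 : s.reg 12 = L₂.length)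
    (hr : Reads s.mem D p ko vo a b (s.reg 11) L₂) (ht : IsTable s.mem p D (s.reg 13) L₁)
    (hfp : D + 2 * p ≤ s.reg 13) (ha : a ≤ 2)
    (hN : s.reg 13 + 2 * L₂.length ≤ N) (hL : L₁.length + L₂.length ≤ N) :
    ∃ s' t, Exec N (.while 12 insertBody) s s' t ∧ t ≤ 21 * L₂.length + 1 ∧
      IsTable s'.mem p D (s'.reg 13) (L₁ ++ L₂) ∧ s'.reg 13 = s.reg 13 + 2 * L₂.length ∧
      (∀ r < 11, s'.reg r = s.reg r) ∧ s'.out = s.out ∧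
      (∀ x < D, s'.mem x = s.mem x) ∧ ∀ x, s'.reg 13 ≤ x → s'.mem x = s.mem x := by
  induction L₂ generalizing L₁ s with
  | nil => exact ⟨s, 1, .while_false h12, by simp, by simpa using ht, by simp, by simp, rfl,
      by simp, by simp⟩
  | cons e L ih =>
    obtain ⟨⟨r1, r2, r3, r4⟩, ⟨r5, r6⟩, r7⟩ := hr
    rw [List.length_cons] at hN hL h12
    have hdeg := (ht _ r3).2
    have hle := length_bucket_le L₁ e.1
    obtain ⟨s₁, hs, g11, g12, g13, gr, gout, gmem⟩ := exec_insertBody (N := N) h0 h1 h4 rfl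
      (h5 ▸ r5) (h6 ▸ r6) r3 hfp (by omega) (by omega) (by omega) (by omega) (by omega) (by omega)
    have hlow : ∀ x < D, s₁.mem x = s.mem x := by
      intro x hx
      rw [gmem, insertMem_of_lt hx (by omega)]
    obtain ⟨s₂, t, i1, i2, i3, i4, i5, i6, i7, i8⟩ := ih (L₁ := L₁ ++ [e]) (s := s₁)
      (by rw [gr _ (by omega), h0]) (by rw [gr _ (by omega), h1]) (by rw [gr _ (by omega), h4])
      (by rw [gr _ (by omega), h5]) (by rw [gr _ (by omega), h6]) (by rw [gr _ (by omega), h7])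
      (by rw [gr _ (by omega), h8]) (by rw [g12, h12]; rfl)
      (by rw [g11, h7, h8]; exact r7.congr hlow)
      (by rw [g13, gmem]; exact ht.insert r3 hfp) (by omega) (by omega)
      (by simp; omega)
    refine ⟨s₂, 20 + t + 1, .while_true (by omega) hs i1, ?_, by simpa using i3, ?_, ?_, ?_, ?_, ?_⟩
    · rw [List.length_cons]
      omega
    · rw [List.length_cons, i4, g13]
      omega
    · intro r hr
      rw [i5 r hr, gr r hr]
    · rw [i6, gout]
    · intro x hx
      rw [i7 x hx, hlow x hx]
    · intro x hx
      rw [i8 x hx, gmem, insertMem_of_le (by omega) (by omega)]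

theorem exec_emitList {N lo hi : ℕ} {l : List ℕ} {s : State} (h0 : s.reg 0 = 1)
    (hl : Linked s.mem lo hi (s.reg 14) l) (hN : hi ≤ N) :
    ∃ s' t, Exec N emitList s s' t ∧ t ≤ 5 * l.length + 1 ∧ s'.out = s.out ++ l ∧
      s'.mem = s.mem ∧ ∀ r, r ≠ 14 → r ≠ 16 → s'.reg r = s.reg r := by
  induction l generalizing s with
  | nil => exact ⟨s, 1, .while_false hl, by simp, by simp, rfl, by simp⟩
  | cons w l ih =>
    obtain ⟨g0, g1, g2, g3, g4⟩ := hl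
    set c := block [load 16 14, emit 16, add 14 14 0, load 14 14] with hc
    have he : Exec N c s (c.eval s) 4 := by
      refine Prog.exec_eval (c := c) ?_
      simp only [hc, block, Fits, eval, Function.update_apply]
      simp [h0]
      omega
    obtain ⟨s', t, i1, i2, i3, i4, i5⟩ := ih (s := c.eval s)
      (by simp [hc, block, eval, h0]) (by simpa [hc, block, eval, h0] using g4)
    refine ⟨s', 4 + t + 1, .while_true g0 he i1, ?_, ?_, ?_, ?_⟩
    · rw [List.length_cons]
      omega
    · rw [i3]
      simp [hc, block, eval, g3]
    · rw [i4]
      simp [hc, block, eval]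
    · intro r h h'
      rw [i5 r h h']
      simp [hc, block, eval, h, h']

/-- What is written out for the agents `(v, 1)` and `(v, 2)`: the lengths of their lists, each
followed by the list. The first and the last entry of the list of `(v, 1)` have the numbers
`2 * v + o` and `2 * v + o'`. -/
def segment (o o' : ℕ) (L : List (ℕ × ℕ)) (v : ℕ) : List ℕ :=
  ((bucket L v).length + 2) :: (2 * v + o) ::
    (bucket L v ++ [2 * v + o', 2, 2 * v + o', 2 * v + o])

theorem exec_emitBody {N p D fp v o o' : ℕ} {L : List (ℕ × ℕ)} {s : State} (h0 : s.reg 0 = 1)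
    (h1 : s.reg 1 = 2) (h9 : s.reg 9 = o) (h10 : s.reg 10 = o') (h17 : s.reg 17 = 2 * v)
    (h18 : s.reg 18 = D + 2 * v) (ht : IsTable s.mem p D fp L) (hv : v < p) (ho : o ≤ 1)
    (ho' : o' ≤ 1) (hN : fp ≤ N) (hN' : D + 2 * p + 2 ≤ N) (hL : L.length + 2 ≤ N) :
    ∃ s' t, Exec N emitBody s s' t ∧ t ≤ 5 * (bucket L v).length + 17 ∧
      s'.out = s.out ++ segment o o' L v ∧ s'.mem = s.mem ∧ s'.reg 17 = 2 * (v + 1) ∧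
      s'.reg 18 = D + 2 * (v + 1) ∧ s'.reg 12 = s.reg 12 - 1 ∧
      (∀ r < 11, s'.reg r = s.reg r) ∧ s'.reg 13 = s.reg 13 := by
  obtain ⟨hlink, hlen⟩ := ht v hv
  have hle := length_bucket_le L v
  unfold emitBody
  set c := block [load 14 18, add 18 18 0, load 16 18, add 18 18 0, add 16 16 1, emit 16,
    add 16 17 9, emit 16] with hc
  set d := block [add 16 17 10, emit 16, emit 1, emit 16, add 16 17 9, emit 16, add 17 17 1,
    sub 12 12 0] with hd
  have he : Exec N c s (c.eval s) 8 := by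
    refine Prog.exec_eval (c := c) ?_
    simp only [hc, block, Fits, eval, Function.update_apply]
    simp [h0, h1, h9, h17, h18, hlen]
    omega
  obtain ⟨s', t, i1, i2, i3, i4, i5⟩ := exec_emitList (N := N) (lo := D + 2 * p) (hi := fp)
    (l := bucket L v) (s := c.eval s) (by simp [hc, block, eval, h0])
    (by simpa [hc, block, eval, h18] using hlink) hN
  have hs' : ∀ r, r ≠ 14 → r ≠ 16 → r ≠ 18 → s'.reg r = s.reg r := by
    intro r g1 g2 g3
    rw [i5 r g1 g2]
    simp [hc, block, eval, g1, g2, g3]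
  have hf : Exec N d s' (d.eval s') 8 := by
    refine Prog.exec_eval (c := d) ?_
    simp only [hd, block, Fits, eval, Function.update_apply]
    simp [hs', h1, h9, h10, h17]
    omega
  refine ⟨d.eval s', 8 + (t + 8), .seq he (.seq i1 hf), by omega, ?_, ?_, ?_, ?_, ?_, ?_, ?_⟩
  · simp [hd, block, eval, hs', h0, h1, h9, h10, h17, i3, segment]
    simp [hc, block, eval, h0, h1, h9, h17, h18, hlen]
  · simp [hd, block, eval, i4]
    simp [hc, block, eval]
  · simp [hd, block, eval, hs', h1, h17]
    ring
  · simp [hd, block, eval, i5]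
    simp [hc, block, eval, h0, h18]
    ring
  · simp [hd, block, eval, hs', h0]
  · intro r hr
    simp only [hd, block, eval, Function.update_apply]
    repeat rw [if_neg (by omega)]
    exact hs' r (by omega) (by omega) (by omega)
  · simp [hd, block, eval, hs']

theorem exec_emitLoop {N p D fp o o' n v : ℕ} {L : List (ℕ × ℕ)} {s : State} (h0 : s.reg 0 = 1)
    (h1 : s.reg 1 = 2) (h9 : s.reg 9 = o) (h10 : s.reg 10 = o') (h12 : s.reg 12 = n)
    (h17 : s.reg 17 = 2 * v) (h18 : s.reg 18 = D + 2 * v) (ht : IsTable s.mem p D fp L)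
    (hv : v + n = p) (ho : o ≤ 1) (ho' : o' ≤ 1) (hN : fp ≤ N) (hN' : D + 2 * p + 2 ≤ N)
    (hL : L.length + 2 ≤ N) :
    ∃ s' t, Exec N (.while 12 emitBody) s s' t ∧
      t ≤ 5 * ((List.range' v n).map (fun v => (bucket L v).length)).sum + 18 * n + 1 ∧
      s'.out = s.out ++ (List.range' v n).flatMap (segment o o' L) ∧ s'.mem = s.mem ∧
      (∀ r < 11, s'.reg r = s.reg r) ∧ s'.reg 13 = s.reg 13 := by
  induction n generalizing v s with
  | zero => exact ⟨s, 1, .while_false h12, by simp, by simp, rfl, by simp, rfl⟩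
  | succ n ih =>
    obtain ⟨s₁, t₁, g1, g2, g3, g4, g5, g6, g7, g8, g9⟩ := exec_emitBody (N := N) h0 h1 h9 h10 h17
      h18 ht (by omega) ho ho' hN hN' hL
    obtain ⟨s₂, t₂, i1, i2, i3, i4, i5, i6⟩ := ih (v := v + 1) (s := s₁)
      (by rw [g8 _ (by omega), h0]) (by rw [g8 _ (by omega), h1]) (by rw [g8 _ (by omega), h9])
      (by rw [g8 _ (by omega), h10]) (by rw [g7, h12]; rfl) g5 g6 (g4 ▸ ht) (by omega)
    refine ⟨s₂, t₁ + t₂ + 1, .while_true (by omega) g1 i1, ?_, ?_, ?_, ?_, ?_⟩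
    · rw [List.range'_succ, List.map_cons, List.sum_cons]
      omega
    · rw [i3, g3, List.range'_succ, List.flatMap_cons, List.append_assoc]
    · rw [i4, g4]
    · intro r hr
      rw [i5 r hr, g8 r hr]
    · rw [i6, g9]

/-- The memory from `D` on must be empty, and is empty again from `D + 2 * p + 2 * L.length` on after
the run. This, together with the unchanged memory below `D`, allows a second run with its table
behind that of the first. -/
theorem exec_sideProg {N p D ko vo a b o o' : ℕ} {L : List (ℕ × ℕ)} {s : State} (h0 : s.reg 0 = 1)
    (h1 : s.reg 1 = 2) (h2 : s.reg 2 = p) (h3 : s.reg 3 = L.length) (h4 : s.reg 4 = D)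
    (h5 : s.reg 5 = ko) (h6 : s.reg 6 = vo) (h7 : s.reg 7 = a) (h8 : s.reg 8 = b)
    (h9 : s.reg 9 = o) (h10 : s.reg 10 = o') (hr : Reads s.mem D p ko vo a b (s.reg 11) L)
    (ha : a ≤ 2) (ho : o ≤ 1) (ho' : o' ≤ 1) (hmem : ∀ x, D ≤ x → s.mem x = 0)
    (hN : D + 2 * p + 2 * L.length + 2 ≤ N) :
    ∃ s' t, Exec N sideProg s s' t ∧ t ≤ 26 * L.length + 18 * p + 11 ∧
      s'.out = s.out ++ (List.range p).flatMap (segment o o' L) ∧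
      (∀ r < 11, s'.reg r = s.reg r) ∧ s'.reg 13 = D + 2 * p + 2 * L.length ∧
      (∀ x < D, s'.mem x = s.mem x) ∧
      ∀ x, D + 2 * p + 2 * L.length ≤ x → s'.mem x = 0 := by
  unfold sideProg
  set c := block [const 12 0, add 12 12 3, add 13 2 2, add 13 13 4] with hc
  set d := block [const 12 0, add 12 12 2, const 18 0, add 18 18 4, const 17 0] with hd
  have he : Exec N c s (c.eval s) 4 := by
    refine Prog.exec_eval (c := c) ?_
    simp only [hc, block, Fits, eval, Function.update_apply]
    simp [h2, h3, h4]
    omega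
  have hcr : ∀ r < 12, (c.eval s).reg r = s.reg r := by
    intro r hr
    simp only [hc, block, eval, Function.update_apply]
    repeat rw [if_neg (by omega)]
  have hc13 : (c.eval s).reg 13 = D + 2 * p := by
    simp [hc, block, eval, h2, h4]
    ring
  have hcm : (c.eval s).mem = s.mem := by simp [hc, block, eval]
  obtain ⟨s₁, t₁, g1, g2, g3, g4, g5, g6, g7, g8⟩ := exec_insertLoop (N := N) (p := p) (L₁ := [])
    (L₂ := L) (s := c.eval s) (by rw [hcr _ (by omega), h0]) (by rw [hcr _ (by omega), h1])
    (by rw [hcr _ (by omega), h4]) (by rw [hcr _ (by omega), h5]) (by rw [hcr _ (by omega), h6])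
    (by rw [hcr _ (by omega), h7]) (by rw [hcr _ (by omega), h8])
    (by simp [hc, block, eval, h3]) (by rw [hcr _ (by omega), hcm]; exact hr)
    (by
      intro v hv
      rw [hcm, hmem _ (by omega), hmem _ (by omega)]
      simp [bucket, Linked])
    (by rw [hc13]) ha (by omega) (by simp; omega)
  rw [hc13] at g4
  rw [hcm] at g7 g8
  have gr : ∀ r < 11, s₁.reg r = s.reg r := fun r hr => by rw [g5 r hr, hcr r (by omega)]
  have hf : Exec N d s₁ (d.eval s₁) 5 := by
    refine Prog.exec_eval (c := d) ?_
    simp only [hd, block, Fits, eval, Function.update_apply]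
    simp [gr, h2, h4]
    omega
  have hdr : ∀ r < 11, (d.eval s₁).reg r = s.reg r := by
    intro r hr
    rw [← gr r hr]
    simp only [hd, block, eval, Function.update_apply]
    repeat rw [if_neg (by omega)]
  have hdm : (d.eval s₁).mem = s₁.mem := by simp [hd, block, eval]
  obtain ⟨s₂, t₂, i1, i2, i3, i4, i5, i6⟩ := exec_emitLoop (N := N) (n := p) (v := 0) (D := D)
    (L := L) (s := d.eval s₁) (by rw [hdr _ (by omega), h0]) (by rw [hdr _ (by omega), h1])
    (by rw [hdr _ (by omega), h9]) (by rw [hdr _ (by omega), h10])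
    (by simp [hd, block, eval, gr, h2]) (by simp [hd, block, eval])
    (by simp [hd, block, eval, gr, h4]) (by rw [hdm]; exact g3) (by omega) ho ho' (by omega)
    (by omega) (by omega)
  rw [← List.range_eq_range'] at i2 i3
  have hsum := sum_length_bucket L p
  refine ⟨s₂, 4 + (t₁ + (5 + t₂)), .seq he (.seq g1 (.seq hf i1)), by omega, ?_, ?_, ?_, ?_, ?_⟩
  · rw [i3]
    simp [hd, block, eval, g6]
    simp [hc, block, eval]
  · intro r hr
    rw [i5 r hr, hdr r hr]
  · rw [i6, ← g4]
    simp [hd, block, eval]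
  · intro x hx
    rw [i4, hdm, g7 x hx]
  · intro x hx
    rw [i4, hdm, g8 x (by omega), hmem x (by omega)]

/-! ### The input and the output of the program -/

variable {p : ℕ} {E : List (Fin p × Fin p)}

theorem graphCode_getD_of_le {x : ℕ} (hx : 2 + 2 * E.length ≤ x) : (graphCode E).getD x 0 = 0 := by
  rw [List.getD_eq_getElem?_getD, List.getElem?_eq_none]
  · rfl
  · simp [graphCode]
    omega

theorem flatMap_pair_getD {X : Type*} (f g : X → ℕ) (l : List X) (k : ℕ) (hk : k < l.length) :
    (l.flatMap (fun e => [f e, g e])).getD (2 * k) 0 = f l[k] ∧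
      (l.flatMap (fun e => [f e, g e])).getD (2 * k + 1) 0 = g l[k] := by
  induction l generalizing k with
  | nil => simp at hk
  | cons e l ih =>
    rcases k with _ | k
    · simp
    · simpa [mul_add] using ih k (by simpa using hk)

theorem graphCode_getD {k : ℕ} (hk : k < E.length) :
    (graphCode E).getD (2 * k + 2) 0 = E[k].1 ∧ (graphCode E).getD (2 * k + 2 + 1) 0 = E[k].2 := by
  simpa [graphCode] using flatMap_pair_getD (fun e : Fin p × Fin p => (e.1 : ℕ)) (fun e => (e.2 : ℕ))
    E k hk

/-- The first `k` edges read backwards, each as the pair of its upper and its lower end. The edge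
with the index `i` occupies the cells `2 * i + 2` and `2 * i + 3`; with the offset `1` for the key and
`0` for the value, the pointer starts at `2 * (k - 1) + 2`. -/
theorem reads_reverse (k : ℕ) (hk : k ≤ E.length) :
    Reads (fun x => (graphCode E).getD x 0) (2 + 2 * E.length) p 1 0 0 2 (2 * k)
      ((E.take k).reverse.map (fun e => ((e.2 : ℕ), (e.1 : ℕ)))) := by
  induction k with
  | zero => simp [Reads]
  | succ k ih =>
    obtain ⟨h1, h2⟩ := graphCode_getD (E := E) (k := k) hk
    rw [List.take_succ_eq_append_getElem hk, List.reverse_append]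
    refine ⟨⟨by omega, by omega, Fin.isLt _, Fin.isLt _⟩, ⟨h2, h1⟩, ?_⟩
    exact ih (by omega)

/-- The edges from the index `k` on read forwards, each as the pair of its lower and its upper
end. -/
theorem reads_forward (k : ℕ) (hk : k ≤ E.length) {mem : ℕ → ℕ} {D : ℕ}
    (hD : 2 + 2 * E.length ≤ D)
    (hm : ∀ x < 2 + 2 * E.length, mem x = (graphCode E).getD x 0) :
    Reads mem D p 0 1 2 0 (2 * k + 2) ((E.drop k).map (fun e => ((e.1 : ℕ), (e.2 : ℕ)))) := by
  induction hn : E.length - k generalizing k with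
  | zero =>
    rw [List.drop_eq_nil_of_le (by omega)]
    trivial
  | succ n ih =>
    have hk' : k < E.length := by omega
    obtain ⟨h1, h2⟩ := graphCode_getD (E := E) (k := k) hk'
    rw [List.drop_eq_getElem_cons hk']
    refine ⟨⟨by omega, by omega, Fin.isLt _, Fin.isLt _⟩, ⟨?_, ?_⟩, ?_⟩
    · rw [hm _ (by omega)]
      exact h1
    · rw [hm _ (by omega)]
      exact h2
    · exact ih (k + 1) (by omega) (by omega)

theorem exists_exec_listProg {N : ℕ} (hN : 100 * (p + E.length + 1) ≤ N) :
    ∃ s t, Exec N listProg (State.init (graphCode E)) s t ∧ t ≤ 100 * (p + E.length + 1) ∧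
      s.out = (List.range p).flatMap
          (segment 0 1 (E.reverse.map (fun e => ((e.2 : ℕ), (e.1 : ℕ))))) ++
        (List.range p).flatMap (segment 1 0 (E.map (fun e => ((e.1 : ℕ), (e.2 : ℕ))))) := by
  unfold listProg
  set s := State.init (graphCode E) with hs
  have hsr : ∀ r, s.reg r = 0 := fun r => rfl
  have hsm : s.mem = fun x => (graphCode E).getD x 0 := rfl
  have hm0 : s.mem 0 = p := rfl
  have hm1 : s.mem 1 = E.length := rfl
  set c := block [const 0 1, const 1 2, load 2 14, load 3 0, add 11 3 3, add 4 11 1, const 5 1,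
    const 8 2, const 10 1] with hc
  set d := block [const 4 0, add 4 4 13, const 5 0, const 6 1, const 7 2, const 8 0, const 9 1,
    const 10 0, const 11 2] with hd
  have he : Exec N c s (c.eval s) 9 := by
    refine Prog.exec_eval (c := c) ?_
    simp only [hc, block, Fits, eval, Function.update_apply]
    simp [hm1]
    omega
  have hcm : (c.eval s).mem = s.mem := by simp [hc, block, eval]
  have hc11 : (c.eval s).reg 11 = 2 * E.length := by
    simp [hc, block, eval, hm1]
    ring
  obtain ⟨s₁, t₁, g1, g2, g3, g4, g5, g6, g7⟩ := exec_sideProg (N := N) (p := p)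
    (D := 2 + 2 * E.length) (ko := 1) (vo := 0) (a := 0) (b := 2) (o := 0) (o' := 1)
    (L := E.reverse.map (fun e => ((e.2 : ℕ), (e.1 : ℕ)))) (s := c.eval s)
    (by simp [hc, block, eval]) (by simp [hc, block, eval]) (by simp [hc, block, eval, hsr, hm0])
    (by simp [hc, block, eval, hm1]) (by simp [hc, block, eval, hm1]; ring)
    (by simp [hc, block, eval]) (by simp [hc, block, eval, hsr]) (by simp [hc, block, eval, hsr])
    (by simp [hc, block, eval]) (by simp [hc, block, eval, hsr]) (by simp [hc, block, eval])
    (by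
      rw [hcm, hc11, hsm]
      simpa using reads_reverse E.length le_rfl)
    (by omega) (by omega) (by omega)
    (by
      intro x hx
      rw [hcm]
      exact graphCode_getD_of_le hx)
    (by simp; omega)
  simp only [List.length_map, List.length_reverse] at g2 g5 g7
  have hf : Exec N d s₁ (d.eval s₁) 9 := by
    refine Prog.exec_eval (c := d) ?_
    simp only [hd, block, Fits, eval, Function.update_apply]
    simp [g5]
    omega
  have hdm : (d.eval s₁).mem = s₁.mem := by simp [hd, block, eval]
  have hd11 : (d.eval s₁).reg 11 = 2 * 0 + 2 := by simp [hd, block, eval]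
  obtain ⟨s₂, t₂, i1, i2, i3, -⟩ := exec_sideProg (N := N) (p := p)
    (D := 2 + 2 * E.length + 2 * p + 2 * E.length) (ko := 0) (vo := 1) (a := 2) (b := 0) (o := 1)
    (o' := 0) (L := E.map (fun e => ((e.1 : ℕ), (e.2 : ℕ)))) (s := d.eval s₁)
    (by simp [hd, block, eval, g4]; simp [hc, block, eval])
    (by simp [hd, block, eval, g4]; simp [hc, block, eval])
    (by simp [hd, block, eval, g4]; simp [hc, block, eval, hsr, hm0])
    (by simp [hd, block, eval, g4]; simp [hc, block, eval, hm1])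
    (by simp [hd, block, eval, g5])
    (by simp [hd, block, eval]) (by simp [hd, block, eval]) (by simp [hd, block, eval])
    (by simp [hd, block, eval]) (by simp [hd, block, eval]) (by simp [hd, block, eval])
    (by
      rw [hdm, hd11]
      refine reads_forward 0 (by omega) (by omega) fun x hx => ?_
      rw [g6 x hx, hcm, hsm])
    (by omega) (by omega) (by omega)
    (by
      intro x hx
      rw [hdm]
      exact g7 x hx)
    (by simp; omega)
  rw [List.length_map] at i2
  refine ⟨s₂, 9 + (t₁ + (9 + t₂)), .seq he (.seq g1 (.seq hf i1)), by omega, ?_⟩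
  rw [i3]
  exact congrArg (· ++ _) g3

theorem idxOf_agentList [BEq (Fin p × ℕ)] [LawfulBEq (Fin p × ℕ)] (v : Fin p) :
    (agentList E (fun _ => 1)).idxOf (v, 1) = 2 * (v : ℕ) ∧
      (agentList E (fun _ => 1)).idxOf (v, 2) = 2 * (v : ℕ) + 1 := by
  rw [agentList_one]
  suffices h : ∀ (l : List (Fin p)), v ∈ l →
      (l.flatMap (fun v => [(v, 1), (v, 2)])).idxOf (v, 1) = 2 * l.idxOf v ∧
      (l.flatMap (fun v => [(v, 1), (v, 2)])).idxOf (v, 2) = 2 * l.idxOf v + 1 by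
    simpa using h _ (List.mem_finRange v)
  intro l hl
  induction l with
  | nil => simp at hl
  | cons x l ih =>
    by_cases hx : x = v
    · subst hx
      simp
    · have := ih (by simpa [Ne.symm hx] using hl)
      simp [hx, this]
      omega

theorem bucket_men (v : Fin p) : bucket (E.reverse.map (fun e => ((e.2 : ℕ), (e.1 : ℕ)))) v =
    (E.filter (fun e => e.2 = v)).map (fun e => 2 * (e.1 : ℕ)) := by
  simp [bucket, List.filter_map, Function.comp_def, Fin.ext_iff]

theorem bucket_women (v : Fin p) : bucket (E.map (fun e => ((e.1 : ℕ), (e.2 : ℕ)))) v =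
    (E.filter (fun e => e.1 = v)).reverse.map (fun e => 2 * (e.2 : ℕ)) := by
  simp [bucket, List.filter_map, Function.comp_def, Fin.ext_iff]

theorem code_constructInstance :
    (constructInstance E (fun _ => 1)).code (agentList E (fun _ => 1)) (agentList E (fun _ => 1)) =
      (List.range p).flatMap (segment 0 1 (E.reverse.map (fun e => ((e.2 : ℕ), (e.1 : ℕ))))) ++
        (List.range p).flatMap (segment 1 0 (E.map (fun e => ((e.1 : ℕ), (e.2 : ℕ))))) := by
  have hrange : List.range p = (List.finRange p).map Fin.val := by simp
  have h (f : Fin p × ℕ → List ℕ) : (agentList E (fun _ => 1)).flatMap f =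
      (List.finRange p).flatMap (fun v => f (v, 1) ++ f (v, 2)) := by
    rw [agentList_one, List.flatMap_assoc]
    simp
  rw [Instance.code, h, h, hrange, List.flatMap_map, List.flatMap_map]
  congr 1
  · refine List.flatMap_congr fun v _ => ?_
    rw [segment, bucket_men]
    simp [manPref_one, manPref_two, idxOf_agentList, Function.comp_def]
  · refine List.flatMap_congr fun v _ => ?_
    rw [segment, bucket_women]
    simp [womanPref_one, womanPref_two, idxOf_agentList, Function.comp_def]

theorem computes_listProg {q : ℕ} (hq : E.length = q) :
    listProg.Computes (100 * (p + q + 1)) (100 * (p + q + 1)) (graphCode E)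
      ((constructInstance E (fun _ => 1)).code (agentList E (fun _ => 1))
        (agentList E (fun _ => 1))) := by
  subst hq
  rw [code_constructInstance]
  exact exists_exec_listProg le_rfl

end StableMarriage

open StableMarriage in
theorem mainTheorem2 :
    ∃ (prog : Prog) (K : ℕ), ∀ (α : Type*) [PartialOrder α] (p q : ℕ) (e : Fin p ≃ α)
      (E : List (Fin p × Fin p)), IsHasseEdgeList e E → E.length = q →
      ∀ I : Instance (Fin p × ℕ) (Fin p × ℕ), I = constructInstance E (fun _ => 1) →
      ∀ L : List (Fin p × ℕ), L = agentList E (fun _ => 1) →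
        (I.IsSMInstance ∧ I.HasSize (2 * p) ∧ I.Realizes α) ∧
        (I.complete L L).IsCompletion I ∧
        (∀ J : Instance (Fin p × ℕ) (Fin p × ℕ), J.IsCompletion I →
          J.IsSMInstance ∧ J.HasCompleteLists ∧ J.HasSize (2 * p) ∧ J.Realizes α) ∧
        prog.Computes (K * (p + q + 1)) (K * (p + q + 1)) (graphCode E) (I.code L L) := by
  refine ⟨listProg, 100, ?_⟩
  rintro α _ p q e E hE hq I rfl L rfl
  have hI := isGadget_constructInstance hE.1 fun v hv => ((hE.2 v v).1 hv).lt.false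
  refine ⟨⟨hI.isSMInstance hE, hasSize_constructInstance, hI.realizes hE⟩,
    isCompletion_complete hI, fun J hJ => ?_, computes_listProg hq⟩
  have hG := isGadget_of_isCompletion hJ
  obtain ⟨hmen, hwomen, hm, hw⟩ := hJ
  refine ⟨hG.isSMInstance hE, ⟨fun m h w h' => ?_, fun w h m h' => ?_⟩, ?_, hG.realizes hE⟩
  · exact ((hm m (hmen ▸ h)).2.2 w).2 (hwomen ▸ h')
  · exact ((hw w (hwomen ▸ h)).2.2 m).2 (hmen ▸ h')
  · rw [Instance.HasSize, hmen, hwomen]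
    exact hasSize_constructInstance
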